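/- Let $n\ge 1$ and realize $\mathrm{SU}(n,1)$ as the group of matrices in $\mathrm{SL}(n+1,\mathbb C)$ preserving the Hermitian form with matrix $\mathrm{diag}\big(\mathrm{Id}_{n-1},\begin{pmatrix}0&1\\1&0\end{pmatrix}\big)$. Put $A_0=\mathrm{diag}(0,\dots,0,1,-1)$, $\mathfrak a=\mathbb RA_0$, and $\mathfrak n=\mathfrak n_1+\mathfrak n_2$, where $$\mathfrak n_1=\left\{\begin{pmatrix}0&0&v\\-v^*&0&0\\0&0&0\end{pmatrix}: v\in\mathbb C^{n-1}\right\},\qquad \mathfrak n_2=\mathbb R\begin{pmatrix}0&0&0\\0&0&i\\0&0&0\end{pmatrix};$$ let $N$ be the connected group with Lie algebra $\mathfrak n$, and let $\mathrm S(\mathrm U(n-1)\mathrm U(1))$ be the group of matrices $\mathrm{diag}(B,z,z)$ of determinant $1$ with $B\in\mathrm U(n-1)$, $|z|=1$, and $\mathfrak s(\mathfrak u(n-1)+\mathfrak u(1))$ its Lie algebra. Let $F_r$ be a connected closed subgroup of $\mathrm S(\mathrm U(n-1)\mathrm U(1))\,\mathbb R$, $\mathbb R=\exp\mathfrak a$,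 with non-trivial projection to $\mathbb R$, and put $G=F_rN$, $H=F_r\cap \mathrm S(\mathrm U(n-1)\mathrm U(1))$, so that $\mathbb C\mathrm H(n)=G/H$. Denote by $\mathfrak g,\mathfrak h,\mathfrak f_r$ the Lie algebras of $G,H,F_r$, let $\mathfrak a_r$ be the orthogonal complement of $\mathfrak h$ in $\mathfrak f_r$ for the inner product $k(E,E')=\mathrm{Re}\,\mathrm{tr}(E^*E')$, and put $\mathfrak s=\mathfrak a+\mathfrak n$, $\mathfrak s_r=\mathfrak a_r+\mathfrak n$. Let $\mathfrak g=\mathfrak h+\mathfrak m$ be any reductive decomposition, that is, $\mathfrak m$ is an $\mathrm{Ad}(H)$-invariant complement of $\mathfrak h$ in $\mathfrak g$. Then there is exactly one $A_r\in\mathfrak a_r$ with $A_r-A_0\in\mathfrak s(\mathfrak u(n-1)+\mathfrak u(1))$, and there is exactly one $\mathfrak h$-equivariant linear map $\varphi_r:\mathfrak s_r\to\mathfrak h$ whose graph is $\mathfrak m$, that is, with $\mathfrak m=\{X+\varphi_r(X):X\in\mathfrak s_r\}$. Let $\chi_r:\mathfrak s\to\mathfrak s_r$ be the linear map with $\chi_r(A_0)=A_r$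 that is the identity on $\mathfrak n$, and let $\varphi=\varphi_r\circ\chi_r:\mathfrak s\to\mathfrak h$. Let $\mathfrak k\subset\mathfrak h$ be the Lie algebra of the holonomy group, with reference point $1\in G$, of the canonical connection of this decomposition, i.e. of the $G$-invariant connection in the principal $H$-bundle $G\to G/H=\mathbb C\mathrm H(n)$ whose horizontal space at $g\in G$ is $g\,\mathfrak m$. (Thus the holonomy group consists of the $h\in H$ that can be joined to $1$ by a piecewise $C^1$ curve $\gamma$ in $G$ with $\gamma^{-1}\gamma'\in\mathfrak m$.) Then $$\mathfrak k=\varphi_r(\mathfrak n)=\varphi(\mathfrak n).$$ -/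

import Mathlib

open Matrix

noncomputable section

namespace CHn

/-- Complex matrices of size `n + 1` (for `n ≥ 1`), the index set split as `(n - 1) + 2`. The
Hermitian form of signature `(n, 1)` is given by `diag (Id, (0 1; 1 0))`. -/
abbrev Mat (n : ℕ) := Matrix (Fin (n - 1) ⊕ Fin 2) (Fin (n - 1) ⊕ Fin 2) ℂ

/-- `SL(n + 1, ℂ)`, the ambient group of `SU(n, 1)`. -/
abbrev SLn (n : ℕ) := Matrix.SpecialLinearGroup (Fin (n - 1) ⊕ Fin 2) ℂ

/-- The matrix of an element of `SL(n + 1, ℂ)`. -/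
def mat {n : ℕ} : SLn n →* Mat n where
  toFun g := g.1
  map_one' := rfl
  map_mul' _ _ := rfl

/-! ### Matrices of the Iwasawa decomposition -/

/-- `A₀ = diag (0, …, 0, 1, -1)`. -/
def A0 (n : ℕ) : Mat n := fromBlocks 0 0 0 !![1, 0; 0, -1]

/-- `N₂`, spanning the root space of `2λ`. -/
def N2 (n : ℕ) : Mat n := fromBlocks 0 0 0 !![0, Complex.I; 0, 0]

/-- The matrix `(0 0 v; -v* 0 0; 0 0 0)`, depending real-linearly on `v ∈ ℂⁿ⁻¹`. -/
def N1 (n : ℕ) : (Fin (n - 1) → ℂ) →ₗ[ℝ] Mat n where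
  toFun v := fromBlocks 0 (of fun i j => ![0, v i] j) (of fun i j => ![-star (v j), 0] i) 0
  map_add' v w := by
    ext (i | i) (j | j)
    · simp
    · fin_cases j <;> simp
    · fin_cases i <;> simp [add_comm]
    · simp
  map_smul' c v := by
    ext (i | i) (j | j)
    · simp
    · fin_cases j <;> simp
    · fin_cases i <;> simp
    · simp

/-- `𝔫₁`, the root space of `λ`. -/
def n1 (n : ℕ) : Submodule ℝ (Mat n) := LinearMap.range (N1 n)

/-- `𝔫₂ = ℝ N₂`, the root space of `2λ`. -/
def n2 (n : ℕ) : Submodule ℝ (Mat n) := Submodule.span ℝ {N2 n}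

/-- `𝔫 = 𝔫₁ + 𝔫₂`. -/
def nil (n : ℕ) : Submodule ℝ (Mat n) := n1 n ⊔ n2 n

/-- `𝔞 = ℝ A₀`. -/
def aLie (n : ℕ) : Submodule ℝ (Mat n) := Submodule.span ℝ {A0 n}

/-- `𝔰 = 𝔞 + 𝔫`. -/
def sLie (n : ℕ) : Submodule ℝ (Mat n) := aLie n ⊔ nil n

/-- `𝔰(𝔲(n-1) + 𝔲(1))`: the matrices `diag (B, z, z)` of trace zero with `B` skew-Hermitian and
`z` imaginary. -/
def suu (n : ℕ) : Submodule ℝ (Mat n) where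
  carrier := {X | ∃ (B : Matrix (Fin (n - 1)) (Fin (n - 1)) ℂ) (z : ℂ),
    Bᴴ = -B ∧ star z = -z ∧ B.trace + 2 * z = 0 ∧ X = fromBlocks B 0 0 (z • 1)}
  zero_mem' := ⟨0, 0, by simp, by simp, by simp, by simp⟩
  add_mem' := by
    rintro _ _ ⟨B, z, hB, hz, ht, rfl⟩ ⟨B', z', hB', hz', ht', rfl⟩
    refine ⟨B + B', z + z', ?_, ?_, ?_, ?_⟩
    · rw [conjTranspose_add, hB, hB']; abel
    · rw [star_add, hz, hz']; ring
    · rw [trace_add]; linear_combination ht + ht'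
    · rw [fromBlocks_add, add_smul]; simp
  smul_mem' := by
    rintro c _ ⟨B, z, hB, hz, ht, rfl⟩
    refine ⟨c • B, c • z, ?_, ?_, ?_, ?_⟩
    · rw [conjTranspose_smul, hB]; simp
    · rw [star_smul, hz]; simp
    · rw [trace_smul, mul_smul_comm, ← smul_add, ht, smul_zero]
    · rw [fromBlocks_smul, smul_assoc]; simp

/-- The inner product `k(E, E') = Re tr (E* E')`. -/
def kForm {n : ℕ} (E E' : Mat n) : ℝ := (Eᴴ * E').trace.re

/-! ### Groups and Lie algebras -/

/-- `S(U(n-1)U(1))`, the centralizer of `𝔞` in the maximal compact subgroup: the matrices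
`diag (B, z, z)` of determinant one with `B` unitary and `|z| = 1`. -/
def SUU (n : ℕ) : Subgroup (SLn n) where
  carrier := {g | ∃ B ∈ unitaryGroup (Fin (n - 1)) ℂ, ∃ z ∈ unitary ℂ,
    mat g = fromBlocks B 0 0 (z • 1)}
  one_mem' := ⟨1, one_mem _, 1, one_mem _, by simp⟩
  mul_mem' := by
    rintro g g' ⟨B, hB, z, hz, h⟩ ⟨B', hB', z', hz', h'⟩
    refine ⟨B * B', mul_mem hB hB', z * z', mul_mem hz hz', ?_⟩
    rw [map_mul, h, h', fromBlocks_multiply]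
    simp [smul_smul, mul_comm z z']
  inv_mem' := by
    rintro g ⟨B, hB, z, hz, h⟩
    refine ⟨star B, Unitary.star_mem hB, star z, Unitary.star_mem hz, ?_⟩
    have h1 : mat g * fromBlocks (star B) 0 0 (star z • 1) = 1 := by
      rw [h, fromBlocks_multiply]
      simp only [Matrix.mul_zero, Matrix.zero_mul, add_zero, zero_add, smul_mul_smul_comm,
        Matrix.mul_one, Unitary.mul_star_self_of_mem hB, Unitary.mul_star_self_of_mem hz, one_smul,
        fromBlocks_one]
    have h2 : mat g⁻¹ * mat g = 1 := by
      rw [← map_mul, inv_mul_cancel, map_one]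
    exact left_inv_eq_right_inv h2 h1

/-- `N`, the connected group with Lie algebra `𝔫`. -/
def Nil (n : ℕ) : Subgroup (SLn n) :=
  Subgroup.closure {g | ∃ X ∈ nil n, mat g = NormedSpace.exp X}

/-- The Lie algebra of a Lie subgroup `K`: the velocities at the identity of the `C¹` curves
that lie in `K`. -/
def lieAlg {n : ℕ} (K : Subgroup (SLn n)) : Submodule ℝ (Mat n) where
  carrier := {X | ∃ γ : ℝ → SLn n, (∀ t, γ t ∈ K) ∧ γ 0 = 1 ∧
    (∀ i j, ContDiff ℝ 1 fun t => mat (γ t) i j) ∧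
    ∀ i j, HasDerivAt (fun t => mat (γ t) i j) (X i j) 0}
  zero_mem' := ⟨fun _ => 1, fun _ => one_mem _, rfl, fun _ _ => contDiff_const,
    fun _ _ => hasDerivAt_const _ _⟩
  add_mem' := by
    rintro X Y ⟨γ, hγ, h0, hc, hd⟩ ⟨δ, hδ, h0', hc', hd'⟩
    refine ⟨fun t => γ t * δ t, fun t => mul_mem (hγ t) (hδ t), by simp [h0, h0'], ?_, ?_⟩
    · intro i j
      simp only [map_mul, Matrix.mul_apply]
      exact ContDiff.sum fun k _ => (hc i k).mul (hc' k j)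
    · intro i j
      have h := HasDerivAt.fun_sum (u := Finset.univ)
        fun k _ => (hd i k).fun_mul (hd' k j)
      simp only [h0, h0', map_one, Matrix.one_apply, mul_ite, mul_one, mul_zero, ite_mul, one_mul,
        zero_mul, Finset.sum_add_distrib, Finset.sum_ite_eq, Finset.sum_ite_eq',
        Finset.mem_univ, if_true] at h
      simp only [map_mul, Matrix.mul_apply]
      exact h
  smul_mem' := by
    rintro c X ⟨γ, hγ, h0, hc, hd⟩
    refine ⟨fun t => γ (c * t), fun t => hγ _, by simp [h0], ?_, ?_⟩
    · intro i j
      exact (hc i j).comp (contDiff_const.mul contDiff_id)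
    · intro i j
      have h1 : HasDerivAt (fun t : ℝ => c * t) c 0 := by
        simpa using (hasDerivAt_id (0 : ℝ)).const_mul c
      have h2 : HasDerivAt (fun t => mat (γ t) i j) (X i j) (c * 0) := by
        simpa using hd i j
      exact h2.scomp (0 : ℝ) h1

/-- The admissible factors `F_r`: connected closed subgroups of `S(U(n-1)U(1)) ℝ`, where
`ℝ = exp 𝔞`, with non-trivial projection to `ℝ`. -/
structure IsAdmissible {n : ℕ} (F : Subgroup (SLn n)) : Prop where
  isClosed : IsClosed (F : Set (SLn n))
  isConnected : IsConnected (F : Set (SLn n))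
  le : ∀ f ∈ F, ∃ u ∈ SUU n, ∃ a : ℝ, mat f = mat u * NormedSpace.exp (a • A0 n)
  proj_nontrivial : ∃ f ∈ F, ∃ u ∈ SUU n, ∃ a : ℝ, a ≠ 0 ∧
    mat f = mat u * NormedSpace.exp (a • A0 n)

variable {n : ℕ} (F : Subgroup (SLn n))

/-- `G = F_r N`. -/
def G : Subgroup (SLn n) := F ⊔ Nil n

/-- The isotropy group `H = F_r ∩ S(U(n-1)U(1))`. -/
def H : Subgroup (SLn n) := F ⊓ SUU n

/-- `𝔞_r`, the `k`-orthogonal complement of `𝔥` in `𝔣_r`. -/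
def aR : Submodule ℝ (Mat n) where
  carrier := {X | X ∈ lieAlg F ∧ ∀ Y ∈ lieAlg (H F), kForm X Y = 0}
  zero_mem' := ⟨zero_mem _, fun Y _ => by simp [kForm]⟩
  add_mem' := by
    rintro X X' ⟨h, hk⟩ ⟨h', hk'⟩
    refine ⟨add_mem h h', fun Y hY => ?_⟩
    have h1 := hk Y hY
    have h2 := hk' Y hY
    simp only [kForm] at h1 h2 ⊢
    rw [conjTranspose_add, Matrix.add_mul, trace_add, Complex.add_re, h1, h2, add_zero]
  smul_mem' := by
    rintro c X ⟨h, hk⟩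
    refine ⟨Submodule.smul_mem _ c h, fun Y hY => ?_⟩
    have h1 := hk Y hY
    simp only [kForm] at h1 ⊢
    rw [conjTranspose_smul, Matrix.smul_mul, trace_smul]
    simp [h1]

/-- `𝔰_r = 𝔞_r + 𝔫`. -/
def sR : Submodule ℝ (Mat n) := aR F ⊔ nil n

/-- The property `A_r = A₀ + H_r ∈ 𝔞_r`, `H_r ∈ 𝔰(𝔲(n-1) + 𝔲(1))`, that singles out the
generator `A_r` of `𝔞_r`. -/
def IsGenerator (A : Mat n) : Prop := A ∈ aR F ∧ A - A0 n ∈ suu n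

/-- The `𝔞`-coordinate: for `X = a A₀ + N` with `N ∈ 𝔫` this is `a`. -/
def aCoord (n : ℕ) : Mat n →ₗ[ℝ] ℝ where
  toFun X := (X (Sum.inr 0) (Sum.inr 0)).re
  map_add' _ _ := by simp
  map_smul' _ _ := by simp

lemma sub_aCoord_mem {X : Mat n} (hX : X ∈ sLie n) : X - aCoord n X • A0 n ∈ nil n := by
  obtain ⟨_, ha, N, hN, rfl⟩ := Submodule.mem_sup.1 hX
  obtain ⟨a, rfl⟩ := Submodule.mem_span_singleton.1 ha
  have h : aCoord n N = 0 := by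
    obtain ⟨_, ⟨v, rfl⟩, _, h2, rfl⟩ := Submodule.mem_sup.1 hN
    obtain ⟨b, rfl⟩ := Submodule.mem_span_singleton.1 h2
    change ((N1 n v + b • N2 n) (Sum.inr 0) (Sum.inr 0)).re = 0
    simp [N1, N2, fromBlocks_smul]
  have h' : aCoord n (A0 n) = 1 := by
    change (A0 n (Sum.inr 0) (Sum.inr 0)).re = 1
    simp [A0]
  rw [map_add, map_smul, h, h']
  simpa using hN

/-- `χ_r : 𝔰 → 𝔰_r`, the linear extension of `A₀ ↦ A_r` and of the identity of `𝔫`. -/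
def chi {A : Mat n} (hA : IsGenerator F A) : sLie n →ₗ[ℝ] sR F where
  toFun X := ⟨aCoord n X • A + ((X : Mat n) - aCoord n X • A0 n),
    Submodule.add_mem_sup (Submodule.smul_mem _ _ hA.1) (sub_aCoord_mem X.2)⟩
  map_add' X Y := by
    ext1
    simp only [Submodule.coe_add, map_add, add_smul]
    abel
  map_smul' c X := by
    ext1
    simp only [Submodule.coe_smul, map_smul, smul_eq_mul, mul_smul, RingHom.id_apply, smul_add,
      smul_sub]

/-! ### Reductive decompositions, canonical connections and holonomy -/

/-- `𝔤 = 𝔥 + 𝔪` is a reductive decomposition: `𝔪` is an `Ad(H)`-invariant complement of `𝔥`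
in the Lie algebra `𝔤` of `G`. -/
structure IsReductive (m : Submodule ℝ (Mat n)) : Prop where
  inf_eq : lieAlg (H F) ⊓ m = ⊥
  sup_eq : lieAlg (H F) ⊔ m = lieAlg (G F)
  ad_mem : ∀ h ∈ H F, ∀ X ∈ m, mat h * X * mat h⁻¹ ∈ m

/-- `φ_r : 𝔰_r → 𝔥` is `𝔥`-equivariant and `𝔪` is its graph in `𝔤 = 𝔰_r + 𝔥`. -/
structure IsGraphMap (m : Submodule ℝ (Mat n)) (φ : sR F →ₗ[ℝ] lieAlg (H F)) : Prop where
  equivariant : ∀ U ∈ lieAlg (H F), ∀ X X' : sR F, (X' : Mat n) = U * X - X * U →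
    (φ X' : Mat n) = U * (φ X : Mat n) - (φ X : Mat n) * U
  graph : ∀ Y : Mat n, Y ∈ m ↔ ∃ X : sR F, Y = X + φ X

variable (m : Submodule ℝ (Mat n))

/-- `a` and `b` are the ends of a `C¹` curve in `G` that is horizontal for the canonical
connection of the principal bundle `G → G/H`, whose horizontal space at `g` is `g 𝔪`; the
function `u` is `γ⁻¹ γ'`. -/
def HorizontalArc (a b : SLn n) : Prop :=
  ∃ (γ : ℝ → SLn n) (u : ℝ → Mat n), γ 0 = a ∧ γ 1 = b ∧
    (∀ i j, ContinuousOn (fun t => u t i j) (Set.Icc 0 1)) ∧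
    ∀ t ∈ Set.Icc (0 : ℝ) 1, γ t ∈ G F ∧ u t ∈ m ∧
      ∀ i j, HasDerivWithinAt (fun s => mat (γ s) i j) ((mat (γ t) * u t) i j)
        (Set.Icc 0 1) t

lemma HorizontalArc.mul_left {a b : SLn n} (h : HorizontalArc F m a b) {g : SLn n}
    (hg : g ∈ G F) : HorizontalArc F m (g * a) (g * b) := by
  obtain ⟨γ, u, h0, h1, hu, hγ⟩ := h
  refine ⟨fun t => g * γ t, u, by simp [h0], by simp [h1], hu, fun t ht => ?_⟩
  obtain ⟨hG, hm, hd⟩ := hγ t ht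
  refine ⟨mul_mem hg hG, hm, fun i j => ?_⟩
  simp only [map_mul, Matrix.mul_assoc]
  rw [Matrix.mul_apply]
  simp only [Matrix.mul_apply (M := mat g)]
  exact HasDerivWithinAt.fun_sum fun k _ => (hd k j).const_mul _

lemma HorizontalArc.symm {a b : SLn n} (h : HorizontalArc F m a b) : HorizontalArc F m b a := by
  obtain ⟨γ, u, h0, h1, hu, hγ⟩ := h
  have hmaps : Set.MapsTo (fun t : ℝ => 1 - t) (Set.Icc 0 1) (Set.Icc 0 1) := by
    intro t ht
    simp only [Set.mem_Icc] at ht ⊢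
    constructor <;> linarith [ht.1, ht.2]
  refine ⟨fun t => γ (1 - t), fun t => -u (1 - t), by simp [h1], by simp [h0], ?_, ?_⟩
  · intro i j
    exact ((hu i j).comp (by fun_prop) hmaps).neg
  · intro t ht
    obtain ⟨hG, hm, hd⟩ := hγ (1 - t) (hmaps ht)
    refine ⟨hG, neg_mem hm, fun i j => ?_⟩
    have h2 : HasDerivWithinAt (fun t : ℝ => 1 - t) (-1) (Set.Icc 0 1) t := by
      simpa using (hasDerivWithinAt_id t (Set.Icc (0 : ℝ) 1)).const_sub 1
    have h3 := (hd i j).scomp t h2 hmaps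
    rw [neg_one_smul, ← Matrix.neg_apply, ← Matrix.mul_neg] at h3
    exact h3

/-- `a` and `b` are the ends of a piecewise `C¹` horizontal curve in `G`. -/
def HorizontallyJoined : SLn n → SLn n → Prop := Relation.ReflTransGen (HorizontalArc F m)

lemma HorizontallyJoined.mul_left {a b : SLn n} (h : HorizontallyJoined F m a b) {g : SLn n}
    (hg : g ∈ G F) : HorizontallyJoined F m (g * a) (g * b) :=
  Relation.ReflTransGen.lift (f := fun x => g * x) (fun _ _ h' => h'.mul_left F m hg) _ _ h

lemma HorizontallyJoined.symm {a b : SLn n} (h : HorizontallyJoined F m a b) :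
    HorizontallyJoined F m b a :=
  have : Std.Symm (HorizontalArc F m) := ⟨fun _ _ h' => h'.symm F m⟩
  (Relation.ReflTransGen.stdSymm (r := HorizontalArc F m)).symm _ _ h

/-- The holonomy group of the canonical connection with reference point `1 ∈ G`: all `h` in the
fibre `H` over the base point such that `1` and `h` are the ends of a horizontal curve, that is,
of the horizontal lift of a loop in `G/H`. (The canonical linear connection is the one associated
to it on `T(G/H) = G ×_H 𝔪`; as the isotropy representation of `H` on `𝔪` has a discrete kernel,
its holonomy algebra is the same subalgebra of `𝔥`, acting on `𝔪`.) -/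
def holonomyGroup : Subgroup (SLn n) where
  carrier := {h | h ∈ H F ∧ HorizontallyJoined F m 1 h}
  one_mem' := ⟨one_mem _, Relation.ReflTransGen.refl⟩
  mul_mem' := by
    rintro a b ⟨ha, ha'⟩ ⟨hb, hb'⟩
    refine ⟨mul_mem ha hb, ha'.trans ?_⟩
    have h := hb'.mul_left F m (g := a) (le_sup_left (a := F) (b := Nil n) ha.1)
    rwa [mul_one] at h
  inv_mem' := by
    rintro a ⟨ha, ha'⟩
    refine ⟨inv_mem ha, ?_⟩
    have h := ha'.mul_left F m (g := a⁻¹) (le_sup_left (a := F) (b := Nil n) (inv_mem ha).1)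
    simpa using h.symm F m

/-- The holonomy algebra: the Lie algebra of the holonomy group. -/
def holonomyAlgebra : Submodule ℝ (Mat n) := lieAlg (holonomyGroup F m)

end CHn

end

/-!
The theorem compares the holonomy algebra of the canonical connection of a reductive decomposition
`𝔤 = 𝔥 + 𝔪` with the image of `𝔫` under the equivariant map `φ = φ_r` whose graph is `𝔪`.

*The generator.* For a closed subgroup, `X` is tangent to it exactly if all `exp (t X)` belong to it
(`exp_mem_of_mem_lieAlg`). That `𝔣_r` projects onto `𝔞` is seen by choosing elements of `F` over
points of `exp 𝔞` that tend to `1`, each as near to the identity as possible; a limit of the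
directions in which they approach it is tangent to `F` but not to `H`
(`exists_mem_lieAlg_aCoord_ne_zero`). Orthogonal projection gives `A_r`, and its uniqueness shows
that `H` centralizes it (`commute_generator`). Since every element of `G` is block triangular with
block-diagonal part in `F`, one has `𝔤 = 𝔣_r + 𝔫 = 𝔥 + 𝔰_r` (`lieAlg_G`, `lieAlg_G_eq_sup`), so `φ` is found by linear
algebra; it is `H`-equivariant because `𝔪` is `Ad(H)`-invariant (`graphMap_conj`). Consequently
`A_r + φ A_r` is centralized by `𝔥`, and `φ(𝔫)` is an ideal of `𝔥`.

*The inclusion `φ(𝔫) ⊆ 𝔨`.* By equivariance, `exp (t X) exp (t φ X)` is a horizontal curve for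
`X ∈ 𝔫` (`exp_mul_exp_mem_holonomyBundle`), and so is `exp (t (A_r + φ A_r))`. Put
`a = exp (A_r + φ A_r)` and `Y = Ad(a) X`. Conjugating the first curve with `a`, which commutes with
`φ X`, and comparing the result with the curve of `Y`, one finds that `exp (-t φ Y) exp (t φ X)` runs
in the holonomy group, so `φ (X - Ad(a) X) ∈ 𝔨`. As `Ad(a)` is expanding on `𝔫`, the map
`1 - Ad(a)` is onto `𝔫`.

*The inclusion `𝔨 ⊆ φ(𝔫)`.* The holonomy group need not be closed, so its Lie algebra has to be
bounded by a countability argument. Let `Z ∈ 𝔥` be orthogonal to `φ(𝔫)`. It commutes with `φ(𝔫)` and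
with `A_r + φ A_r`, hence with the block-diagonal part `f` of every point of a horizontal curve from
`1`. The determinants of `f` on the eigenspaces of `Z` are exponentials of integrals of traces, and
at the points of `H` these integrals satisfy a linear relation, as `Z` is orthogonal to `φ(𝔫)`
(`logCondition_of_horizontallyJoined`). For a `C¹` curve `γ` in the holonomy group the same
determinants are exponentials of the corresponding integrals along `γ`, whence the real part of
`∫ tr (Z γ⁻¹ γ')` takes its values in the countable group generated by the numbers `2 π l`, `i l` an
eigenvalue of `Z`. By continuity it vanishes, and so `Z` is orthogonal to the velocity of `γ`
(`kForm_eq_zero_of_mem_holonomyAlgebra`).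
-/

noncomputable section

namespace CHn

open scoped Matrix.Norms.Operator
open Filter Topology NormedSpace

/-! ### Powers near the identity and the exponential -/

lemma norm_pow_sub_pow_le {𝔸 : Type*} [NormedRing 𝔸] [NormOneClass 𝔸] {a b : 𝔸} {M : ℝ}
    (hM : 1 ≤ M) (ha : ‖a‖ ≤ M) (hb : ‖b‖ ≤ M) (k : ℕ) :
    ‖a ^ k - b ^ k‖ ≤ k * M ^ k * ‖a - b‖ := by
  induction k with
  | zero => simp
  | succ k ih =>
    have h : a ^ (k + 1) - b ^ (k + 1) = a ^ k * (a - b) + (a ^ k - b ^ k) * b := by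
      simp only [pow_succ]; noncomm_ring
    have hak : ‖a ^ k‖ ≤ M ^ k := (norm_pow_le a k).trans (by gcongr)
    have h1 : M ^ k ≤ M ^ (k + 1) := pow_le_pow_right₀ hM (Nat.le_succ k)
    calc ‖a ^ (k + 1) - b ^ (k + 1)‖
        ≤ ‖a ^ k‖ * ‖a - b‖ + ‖a ^ k - b ^ k‖ * ‖b‖ := by
          rw [h]
          exact (norm_add_le _ _).trans (add_le_add (norm_mul_le _ _) (norm_mul_le _ _))
      _ ≤ M ^ (k + 1) * ‖a - b‖ + (k * M ^ k * ‖a - b‖) * M := by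
          gcongr
          exact hak.trans h1
      _ = ((k + 1 : ℕ) : ℝ) * M ^ (k + 1) * ‖a - b‖ := by
          push_cast; ring

lemma tendsto_slope_seq {E : Type*} [NormedAddCommGroup E] [NormedSpace ℝ E] {f : ℝ → E} {X : E}
    (h : HasDerivAt f X 0) {s : ℕ → ℝ} (hs : Tendsto s atTop (𝓝 0)) (hs0 : ∀ᶠ j in atTop, s j ≠ 0) :
    Tendsto (fun j => (s j)⁻¹ • (f (s j) - f 0)) atTop (𝓝 X) := by
  have h1 := hasDerivAt_iff_tendsto_slope_zero.1 h
  have h2 : Tendsto s atTop (𝓝[≠] 0) :=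
    tendsto_nhdsWithin_iff.2 ⟨hs, hs0⟩
  simpa [Function.comp_def] using h1.comp h2

/-- If `g j = 1 + X / k j + o (1 / k j)`, then `g j ^ k j → exp X`. -/
lemma tendsto_pow_exp {𝔸 : Type*} [NormedRing 𝔸] [NormOneClass 𝔸] [NormedAlgebra ℝ 𝔸]
    [CompleteSpace 𝔸] {g : ℕ → 𝔸} {k : ℕ → ℕ} {X : 𝔸} (hk : Tendsto k atTop atTop)
    (hg : Tendsto (fun j => (k j : ℝ) • (g j - 1)) atTop (𝓝 X)) :
    Tendsto (fun j => g j ^ k j) atTop (𝓝 (exp X)) := by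
  have hkR : Tendsto (fun j => (k j : ℝ)) atTop atTop := tendsto_natCast_atTop_atTop.comp hk
  have hk0 : ∀ᶠ j in atTop, (k j : ℝ) ≠ 0 :=
    (hkR.eventually_gt_atTop 0).mono fun _ h => h.ne'
  -- The comparison sequence: its `k j`-th power is exactly `exp X`.
  set h : ℕ → 𝔸 := fun j => exp ((k j : ℝ)⁻¹ • X) with hdef
  have hh : Tendsto (fun j => (k j : ℝ) • (h j - 1)) atTop (𝓝 X) := by
    have h0 : HasDerivAt (fun t : ℝ => exp (t • X)) X 0 := by
      simpa using hasDerivAt_exp_smul_const (𝕂 := ℝ) X 0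
    have := tendsto_slope_seq h0 (tendsto_inv_atTop_zero.comp hkR)
      (hk0.mono fun j hj => inv_ne_zero hj)
    simpa [hdef] using this
  have hpow : ∀ᶠ j in atTop, h j ^ k j = exp X := by
    filter_upwards [hk0] with j hj
    have : NormedAlgebra ℚ 𝔸 := NormedAlgebra.restrictScalars ℚ ℝ 𝔸
    rw [hdef]
    simp only
    rw [← NormedSpace.exp_nsmul, ← Nat.cast_smul_eq_nsmul ℝ, smul_smul, mul_inv_cancel₀ hj, one_smul]
  obtain ⟨C, hC0, hC⟩ : ∃ C : ℝ, 0 ≤ C ∧ ‖X‖ < C := ⟨‖X‖ + 1, by positivity, by linarith⟩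
  have hb : ∀ᶠ j in atTop, ‖g j ^ k j - exp X‖ ≤
      Real.exp C * ‖(k j : ℝ) • (g j - 1) - (k j : ℝ) • (h j - 1)‖ := by
    filter_upwards [hk0, hpow, hg.norm.eventually_le_const hC, hh.norm.eventually_le_const hC]
      with j hj hp h1 h2
    have hkpos : (0 : ℝ) < k j := lt_of_le_of_ne (Nat.cast_nonneg _) hj.symm
    have key : ∀ a : 𝔸, ‖(k j : ℝ) • (a - 1)‖ ≤ C → ‖a‖ ≤ 1 + C / k j := by
      intro a ha
      rw [norm_smul, Real.norm_of_nonneg hkpos.le] at ha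
      have : ‖a - 1‖ ≤ C / k j := by rw [le_div_iff₀ hkpos]; linarith
      calc ‖a‖ = ‖1 + (a - 1)‖ := by congr 1; abel
        _ ≤ ‖(1 : 𝔸)‖ + ‖a - 1‖ := norm_add_le _ _
        _ ≤ 1 + C / k j := by rw [norm_one]; linarith
    have h3 := norm_pow_sub_pow_le (by have : 0 ≤ C / k j := by positivity
                                       linarith) (key _ h1) (key _ h2) (k j)
    have h4 : (1 + C / k j) ^ k j ≤ Real.exp C := by
      calc (1 + C / k j) ^ k j ≤ (Real.exp (C / k j)) ^ k j := by
            gcongr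
            linarith [Real.add_one_le_exp (C / k j)]
        _ = Real.exp C := by
            rw [← Real.exp_nat_mul, mul_div_cancel₀ _ hj]
    rw [← hp, ← smul_sub, norm_smul, Real.norm_of_nonneg hkpos.le, sub_sub_sub_cancel_right]
    calc _ ≤ _ := h3
      _ ≤ k j * Real.exp C * ‖g j - h j‖ := by gcongr
      _ = _ := by ring
  have hz : Tendsto (fun j => Real.exp C *
      ‖(k j : ℝ) • (g j - 1) - (k j : ℝ) • (h j - 1)‖) atTop (𝓝 0) := by
    simpa using (hg.sub hh).norm.const_mul (Real.exp C)
  exact tendsto_iff_norm_sub_tendsto_zero.2 (squeeze_zero' (Eventually.of_forall fun _ =>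
    norm_nonneg _) hb hz)

/-! ### Curves of matrices and determinants -/

section Matrices

variable {ι : Type*} [Fintype ι]

lemma hasDerivAt_matrix {f : ℝ → Matrix ι ι ℂ} {f' : Matrix ι ι ℂ} {t : ℝ} :
    HasDerivAt f f' t ↔ ∀ i j, HasDerivAt (fun s => f s i j) (f' i j) t :=
  ⟨fun h i j => hasDerivAt_pi.1 (hasDerivAt_pi.1 h i) j,
    fun h => hasDerivAt_pi.2 fun i => hasDerivAt_pi.2 fun j => h i j⟩

lemma hasDerivWithinAt_matrix {f : ℝ → Matrix ι ι ℂ} {f' : Matrix ι ι ℂ} {s : Set ℝ} {t : ℝ} :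
    HasDerivWithinAt f f' s t ↔ ∀ i j, HasDerivWithinAt (fun s => f s i j) (f' i j) s t :=
  ⟨fun h i j => hasDerivWithinAt_pi.1 (hasDerivWithinAt_pi.1 h i) j,
    fun h => hasDerivWithinAt_pi.2 fun i => hasDerivWithinAt_pi.2 fun j => h i j⟩

variable [DecidableEq ι]

lemma hasDerivAt_exp_entry (X : Matrix ι ι ℂ) (t : ℝ) (i j : ι) :
    HasDerivAt (fun t : ℝ => exp (t • X) i j) ((exp (t • X) * X) i j) t :=
  hasDerivAt_matrix.1 (hasDerivAt_exp_smul_const X t) i j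

lemma continuous_exp_smul (X : Matrix ι ι ℂ) : Continuous fun t : ℝ => exp (t • X) :=
  continuous_iff_continuousAt.2 fun t => (hasDerivAt_exp_smul_const X t).continuousAt

lemma contDiff_exp_entry (X : Matrix ι ι ℂ) (i j : ι) :
    ContDiff ℝ 1 fun t : ℝ => exp (t • X) i j := by
  rw [contDiff_one_iff_deriv]
  refine ⟨fun t => (hasDerivAt_exp_entry X t i j).differentiableAt, ?_⟩
  have : deriv (fun t : ℝ => exp (t • X) i j) = fun t => (exp (t • X) * X) i j :=
    funext fun t => (hasDerivAt_exp_entry X t i j).deriv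
  rw [this]
  exact ((continuous_exp_smul X).mul continuous_const).matrix_elem i j

/-- Jacobi's formula along a curve with logarithmic derivative `u`. -/
lemma hasDerivWithinAt_det {κ : ℝ → Matrix ι ι ℂ} {u : Matrix ι ι ℂ} {s : Set ℝ} {t : ℝ}
    (h : ∀ i j, HasDerivWithinAt (fun s => κ s i j) ((κ t * u) i j) s t) :
    HasDerivWithinAt (fun s => (κ s).det) ((κ t).det * u.trace) s t := by
  have h1 : HasDerivWithinAt (fun s => (κ s).det)
      (∑ σ : Equiv.Perm ι, ((Equiv.Perm.sign σ : ℤ) : ℂ) *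
        ∑ i, (∏ j ∈ Finset.univ.erase i, κ t (σ j) j) • (κ t * u) (σ i) i) s t := by
    simp only [det_apply']
    exact HasDerivWithinAt.fun_sum fun σ _ =>
      (HasDerivWithinAt.fun_finsetProd fun i _ => h (σ i) i).const_mul _
  convert h1 using 1
  have h2 : (κ t).det * u.trace = (adjugate (κ t) * (κ t * u)).trace := by
    rw [← Matrix.mul_assoc, adjugate_mul, smul_mul, Matrix.one_mul, trace_smul, smul_eq_mul]
  have h3 : ∀ i, (adjugate (κ t) * (κ t * u)) i i =
      ((κ t).updateCol i fun k => (κ t * u) k i).det := by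
    intro i
    rw [← cramer_apply, cramer_eq_adjugate_mulVec]
    rfl
  rw [h2, trace]
  simp only [diag_apply, h3, det_apply', Finset.mul_sum]
  rw [Finset.sum_comm]
  refine Finset.sum_congr rfl fun σ _ => Finset.sum_congr rfl fun i _ => ?_
  rw [← Finset.mul_prod_erase _ _ (Finset.mem_univ i), updateCol_self, smul_eq_mul,
    mul_comm ((κ t * u) (σ i) i)]
  congr 2
  refine Finset.prod_congr rfl fun j hj => ?_
  rw [updateCol_ne (Finset.ne_of_mem_erase hj)]

/-- The solution of `y' = y c`, where `w` is a primitive of `c`. -/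
lemma eq_mul_exp_of_hasDerivWithinAt {y w c : ℝ → ℂ} {a b : ℝ} (hab : a ≤ b)
    (hy : ∀ t ∈ Set.Icc a b, HasDerivWithinAt y (y t * c t) (Set.Icc a b) t)
    (hw : ∀ t ∈ Set.Icc a b, HasDerivWithinAt w (c t) (Set.Icc a b) t) :
    y b = y a * Complex.exp (w b - w a) := by
  have hz : ∀ t ∈ Set.Icc a b, HasDerivWithinAt (fun t => y t * Complex.exp (-w t)) 0
      (Set.Icc a b) t := by
    intro t ht
    have := (hy t ht).fun_mul (hw t ht).fun_neg.cexp
    rwa [show y t * c t * Complex.exp (-w t) + y t * (Complex.exp (-w t) * -c t) = 0 by ring]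
      at this
  have h := constant_of_has_deriv_right_zero (fun t ht => (hz t ht).continuousWithinAt)
    (fun t ht => (hz t (Set.Ico_subset_Icc_self ht)).mono_of_mem_nhdsWithin
      (Icc_mem_nhdsGE_of_mem ht)) b ⟨hab, le_rfl⟩
  simp only [Complex.exp_neg] at h
  rw [Complex.exp_sub]
  have h1 := Complex.exp_ne_zero (w b)
  have h2 := Complex.exp_ne_zero (w a)
  field_simp at h ⊢
  exact h

lemma det_exp_eq_one {X : Matrix ι ι ℂ} (hX : X.trace = 0) : (exp X).det = 1 := by
  have h := eq_mul_exp_of_hasDerivWithinAt (y := fun t : ℝ => (exp (t • X)).det) (w := fun _ => 0)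
    (c := fun _ => 0) zero_le_one
    (fun t _ => by
      have := hasDerivWithinAt_det (κ := fun t : ℝ => exp (t • X)) (u := X) (s := Set.Icc 0 1)
        (t := t) fun i j => (hasDerivAt_exp_entry X t i j).hasDerivWithinAt
      rwa [hX] at this) (fun t _ => hasDerivWithinAt_const _ _ _)
  simpa using h

end Matrices

/-! ### Lie algebras of subgroups -/

variable {n : ℕ}

lemma mat_injective : Function.Injective (mat : SLn n → Mat n) := fun _ _ h => Subtype.ext h

@[simp] lemma mat_mul_mat_inv (g : SLn n) : mat g * mat g⁻¹ = 1 := by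
  rw [← map_mul, mul_inv_cancel, map_one]

@[simp] lemma mat_inv_mul_mat (g : SLn n) : mat g⁻¹ * mat g = 1 := by
  rw [← map_mul, inv_mul_cancel, map_one]

lemma det_mat (g : SLn n) : (mat g).det = 1 := g.2

/-- The exponential of a trace-free matrix, as an element of `SL(n + 1, ℂ)`. -/
def expSL (X : Mat n) (hX : X.trace = 0) : SLn n := ⟨exp X, det_exp_eq_one hX⟩

@[simp] lemma mat_expSL (X : Mat n) (hX : X.trace = 0) : mat (expSL X hX) = exp X := rfl

/-- A `C¹` curve of unimodular matrices that starts at the identity with velocity `X`. -/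
structure IsCurve (γ : ℝ → SLn n) (X : Mat n) : Prop where
  zero : γ 0 = 1
  contDiff : ∀ i j, ContDiff ℝ 1 fun t => mat (γ t) i j
  hasDerivAt : ∀ i j, HasDerivAt (fun t => mat (γ t) i j) (X i j) 0

lemma mem_lieAlg_iff {K : Subgroup (SLn n)} {X : Mat n} :
    X ∈ lieAlg K ↔ ∃ γ : ℝ → SLn n, (∀ t, γ t ∈ K) ∧ IsCurve γ X :=
  ⟨fun ⟨γ, h, h0, hc, hd⟩ => ⟨γ, h, h0, hc, hd⟩, fun ⟨γ, h, h0, hc, hd⟩ => ⟨γ, h, h0, hc, hd⟩⟩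

lemma IsCurve.mul {γ δ : ℝ → SLn n} {X Y : Mat n} (hγ : IsCurve γ X) (hδ : IsCurve δ Y) :
    IsCurve (fun t => γ t * δ t) (X + Y) where
  zero := by simp [hγ.zero, hδ.zero]
  contDiff i j := by
    simp only [map_mul, Matrix.mul_apply]
    exact ContDiff.sum fun k _ => (hγ.contDiff i k).mul (hδ.contDiff k j)
  hasDerivAt i j := by
    have h := (hasDerivAt_matrix.2 hγ.hasDerivAt).mul (hasDerivAt_matrix.2 hδ.hasDerivAt)
    have h' := hasDerivAt_matrix.1 h i j
    simpa [hγ.zero, hδ.zero] using h'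

lemma IsCurve.exp {γ : ℝ → SLn n} {X : Mat n} (h : ∀ t, mat (γ t) = exp (t • X)) :
    IsCurve γ X where
  zero := mat_injective (by simp [h])
  contDiff i j := by simpa only [h] using contDiff_exp_entry X i j
  hasDerivAt i j := by simpa [h] using hasDerivAt_exp_entry X 0 i j

lemma IsCurve.trace_eq_zero {γ : ℝ → SLn n} {X : Mat n} (h : IsCurve γ X) : X.trace = 0 := by
  have h1 := hasDerivWithinAt_det (κ := fun t => mat (γ t)) (u := X) (s := Set.univ) (t := 0)
    fun i j => by simpa [h.zero] using h.hasDerivAt i j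
  simp only [det_mat, one_mul] at h1
  rw [hasDerivWithinAt_univ] at h1
  exact h1.unique (hasDerivAt_const _ _)

lemma trace_eq_zero_of_mem_lieAlg {K : Subgroup (SLn n)} {X : Mat n} (h : X ∈ lieAlg K) :
    X.trace = 0 := by
  obtain ⟨γ, _, hγ⟩ := mem_lieAlg_iff.1 h
  exact hγ.trace_eq_zero

lemma lieAlg_mono {K L : Subgroup (SLn n)} (h : K ≤ L) : lieAlg K ≤ lieAlg L := by
  rintro X ⟨γ, hK, hγ⟩
  exact ⟨γ, fun t => h (hK t), hγ⟩

lemma mem_lieAlg_of_exp {K : Subgroup (SLn n)} {X : Mat n} (hX : X.trace = 0)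
    (h : ∀ t : ℝ, ∀ g : SLn n, mat g = exp (t • X) → g ∈ K) : X ∈ lieAlg K :=
  mem_lieAlg_iff.2 ⟨fun t => expSL (t • X) (by simp [hX]), fun t => h t _ rfl,
    IsCurve.exp fun t => rfl⟩

lemma conj_mem_lieAlg {K : Subgroup (SLn n)} {g : SLn n} (hg : ∀ k ∈ K, g * k * g⁻¹ ∈ K)
    {X : Mat n} (hX : X ∈ lieAlg K) : mat g * X * mat g⁻¹ ∈ lieAlg K := by
  obtain ⟨γ, hK, hγ⟩ := mem_lieAlg_iff.1 hX
  refine mem_lieAlg_iff.2 ⟨fun t => g * γ t * g⁻¹, fun t => hg _ (hK t), by simp [hγ.zero], ?_, ?_⟩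
  · intro i j
    simp only [map_mul, Matrix.mul_apply]
    exact ContDiff.sum fun k _ => (ContDiff.sum fun l _ =>
      contDiff_const.mul (hγ.contDiff l k)).mul contDiff_const
  · have h := ((hasDerivAt_matrix.2 hγ.hasDerivAt).const_mul (mat g)).mul_const (mat g⁻¹)
    simp only [map_mul]
    exact hasDerivAt_matrix.1 h

lemma continuous_mat : Continuous (mat : SLn n → Mat n) := continuous_subtype_val

lemma isClosed_image_mat {K : Subgroup (SLn n)} (hK : IsClosed (K : Set (SLn n))) :
    IsClosed (mat '' (K : Set (SLn n))) := by
  have h : Topology.IsClosedEmbedding (mat : SLn n → Mat n) := by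
    refine Topology.IsClosedEmbedding.subtypeVal ?_
    exact isClosed_eq (Continuous.matrix_det continuous_id) continuous_const
  exact h.isClosedMap _ hK

/-- Cartan's criterion: a limit of rescaled increments at the identity exponentiates into a closed
subgroup. -/
lemma exists_mat_eq_exp_of_tendsto {K : Subgroup (SLn n)} (hK : IsClosed (K : Set (SLn n)))
    {g : ℕ → SLn n} (hg : ∀ j, g j ∈ K) {k : ℕ → ℕ} (hk : Tendsto k atTop atTop) {X : Mat n}
    (h : Tendsto (fun j => (k j : ℝ) • (mat (g j) - 1)) atTop (𝓝 X)) :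
    ∃ a ∈ K, mat a = exp X :=
  (isClosed_image_mat hK).mem_of_tendsto (tendsto_pow_exp hk h)
    (Eventually.of_forall fun j => ⟨g j ^ k j, K.pow_mem (hg j) _, by simp⟩)

lemma exp_mem_of_mem_lieAlg {K : Subgroup (SLn n)} (hK : IsClosed (K : Set (SLn n)))
    {X : Mat n} (hX : X ∈ lieAlg K) {a : SLn n} (ha : mat a = exp X) : a ∈ K := by
  obtain ⟨γ, hγK, hγ⟩ := mem_lieAlg_iff.1 hX
  have hpos : ∀ j : ℕ, ((j : ℝ) + 1) ≠ 0 := fun j => by positivity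
  have hs : Tendsto (fun j : ℕ => ((j : ℝ) + 1)⁻¹) atTop (𝓝 0) := by
    simpa using tendsto_one_div_add_atTop_nhds_zero_nat (𝕜 := ℝ)
  have h := tendsto_slope_seq (hasDerivAt_matrix.2 hγ.hasDerivAt) hs
    (Eventually.of_forall fun j => inv_ne_zero (hpos j))
  obtain ⟨b, hb, hb'⟩ := exists_mat_eq_exp_of_tendsto hK (g := fun j => γ (((j : ℝ) + 1)⁻¹))
    (fun j => hγK _) (tendsto_add_atTop_nat 1) (h.congr fun j => by simp [hγ.zero])
  rwa [mat_injective (ha.trans hb'.symm)]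

lemma mem_lieAlg_of_exists_exp {K : Subgroup (SLn n)} {X : Mat n}
    (h : ∀ t : ℝ, 0 ≤ t → ∃ a ∈ K, mat a = exp (t • X)) : X ∈ lieAlg K := by
  have h' : ∀ t : ℝ, ∃ a ∈ K, mat a = exp (t • X) := by
    intro t
    rcases le_total 0 t with ht | ht
    · exact h t ht
    · obtain ⟨a, ha, hat⟩ := h (-t) (neg_nonneg.2 ht)
      refine ⟨a⁻¹, inv_mem ha, ?_⟩
      have h1 : exp (t • X) * mat a = 1 := by
        rw [hat, ← Matrix.exp_add_of_commute _ _ (((Commute.refl X).smul_left t).smul_right (-t)),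
          ← add_smul, add_neg_cancel, zero_smul, NormedSpace.exp_zero]
      calc mat a⁻¹ = (exp (t • X) * mat a) * mat a⁻¹ := by rw [h1, Matrix.one_mul]
        _ = exp (t • X) := by rw [Matrix.mul_assoc, mat_mul_mat_inv, Matrix.mul_one]
  choose γ hγ hγ' using h'
  exact mem_lieAlg_iff.2 ⟨γ, hγ, IsCurve.exp hγ'⟩

/-! ### Block-triangular matrices and the Hermitian form -/

/-- The matrix of the Hermitian form. -/
def formJ (n : ℕ) : Mat n := fromBlocks 1 0 0 !![0, 1; 1, 0]

/-- The order of the blocks of the index set for which `𝔫` is strictly upper triangular. -/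
def lvl (n : ℕ) : Fin (n - 1) ⊕ Fin 2 → ℕ := Sum.elim (fun _ => 1) ![0, 2]

@[simp] lemma lvl_inl (i : Fin (n - 1)) : lvl n (Sum.inl i) = 1 := rfl
@[simp] lemma lvl_inr_zero : lvl n (Sum.inr 0) = 0 := rfl
@[simp] lemma lvl_inr_one : lvl n (Sum.inr 1) = 2 := rfl

/-- The block-diagonal part of a matrix. -/
def dg : Mat n →ₗ[ℝ] Mat n where
  toFun M := of fun i j => if lvl n i = lvl n j then M i j else 0
  map_add' M M' := by ext i j; by_cases h : lvl n i = lvl n j <;> simp [h]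
  map_smul' c M := by ext i j; by_cases h : lvl n i = lvl n j <;> simp [h]

lemma dg_apply (M : Mat n) (i j) : dg M i j = if lvl n i = lvl n j then M i j else 0 := rfl

lemma dg_dg (M : Mat n) : dg (dg M) = dg M := by
  ext i j
  simp only [dg_apply]
  split_ifs <;> rfl

@[simp] lemma dg_one : dg (1 : Mat n) = 1 := by
  ext i j
  rw [dg_apply]
  by_cases h : i = j <;> simp [h]

lemma dg_mul {M M' : Mat n} (h : M.BlockTriangular (lvl n)) (h' : M'.BlockTriangular (lvl n)) :
    dg (M * M') = dg M * dg M' := by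
  ext i j
  rw [dg_apply, Matrix.mul_apply, Matrix.mul_apply]
  split_ifs with hij
  · refine Finset.sum_congr rfl fun k _ => ?_
    rw [dg_apply, dg_apply, ← hij]
    rcases lt_trichotomy (lvl n i) (lvl n k) with hk | hk | hk
    · rw [h' (hij ▸ hk)]; simp
    · simp [hk]
    · rw [h hk]; simp
  · refine (Finset.sum_eq_zero fun k _ => ?_).symm
    rw [dg_apply, dg_apply]
    by_cases h1 : lvl n i = lvl n k
    · rw [← h1, if_neg hij, mul_zero]
    · rw [if_neg h1, zero_mul]

lemma blockTriangular_dg (M : Mat n) : (dg M).BlockTriangular (lvl n) := fun i j h => by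
  rw [dg_apply, if_neg h.ne']

lemma dg_eq_fromBlocks {M : Mat n} (h : dg M = M) : M = fromBlocks M.toBlocks₁₁ 0 0
    !![M (Sum.inr 0) (Sum.inr 0), 0; 0, M (Sum.inr 1) (Sum.inr 1)] := by
  ext i j
  rw [← h, dg_apply]
  rcases i with i | i <;> rcases j with j | j
  · simp [toBlocks₁₁, dg_apply]
  · fin_cases j <;> simp
  · fin_cases i <;> simp
  · fin_cases i <;> fin_cases j <;> simp [dg_apply]

lemma dg_fromBlocks (B : Matrix (Fin (n - 1)) (Fin (n - 1)) ℂ) (p q : ℂ) :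
    dg (fromBlocks B 0 0 !![p, 0; 0, q] : Mat n) = fromBlocks B 0 0 !![p, 0; 0, q] := by
  ext i j
  rw [dg_apply]
  rcases i with i | i <;> rcases j with j | j
  · simp
  · fin_cases j <;> simp
  · fin_cases i <;> simp
  · fin_cases i <;> fin_cases j <;> simp

lemma A0_eq_diagonal (n : ℕ) : A0 n = diagonal (Sum.elim 0 ![1, -1]) := by
  rw [A0, ← diagonal_zero, ← fromBlocks_diagonal]
  congr 1
  ext i j
  fin_cases i <;> fin_cases j <;> simp

lemma commute_A0_iff {M : Mat n} : Commute M (A0 n) ↔ dg M = M := by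
  rw [commute_iff_eq, A0_eq_diagonal, ← Matrix.ext_iff, ← Matrix.ext_iff]
  refine forall_congr' fun i => forall_congr' fun j => ?_
  rw [mul_diagonal, diagonal_mul, dg_apply, mul_comm, ← sub_eq_zero, ← sub_mul, mul_eq_zero]
  rcases i with i | i <;> rcases j with j | j
  · simp
  · fin_cases j <;> simp [eq_comm]
  · fin_cases i <;> simp [eq_comm]
  · fin_cases i <;> fin_cases j <;> norm_num [eq_comm]

/-- The Lie algebra `𝔲(n, 1)` of the Hermitian form. -/
def skewJ (n : ℕ) : Submodule ℝ (Mat n) where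
  carrier := {X | Xᴴ * formJ n + formJ n * X = 0}
  zero_mem' := by simp
  add_mem' {X Y} hX hY := by
    simp only [Set.mem_ofPred_eq] at *
    rw [conjTranspose_add, add_mul, mul_add, add_add_add_comm, hX, hY, add_zero]
  smul_mem' c X hX := by
    simp only [Set.mem_ofPred_eq] at *
    rw [conjTranspose_smul, star_trivial, smul_mul_assoc, mul_smul_comm, ← smul_add, hX, smul_zero]

lemma mem_skewJ {X : Mat n} : X ∈ skewJ n ↔ Xᴴ * formJ n + formJ n * X = 0 := Iff.rfl

/-- The involution of the index set whose permutation matrix is `formJ`. -/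
def flip {n : ℕ} : Fin (n - 1) ⊕ Fin 2 → Fin (n - 1) ⊕ Fin 2 :=
  Sum.map id ![1, 0]

@[simp] lemma flip_inl (i : Fin (n - 1)) : flip (Sum.inl i) = Sum.inl i := rfl
@[simp] lemma flip_inr_zero : flip (Sum.inr 0 : Fin (n - 1) ⊕ Fin 2) = Sum.inr 1 := rfl
@[simp] lemma flip_inr_one : flip (Sum.inr 1 : Fin (n - 1) ⊕ Fin 2) = Sum.inr 0 := rfl

lemma formJ_mul_apply (X : Mat n) (i j) : (formJ n * X) i j = X (flip i) j := by
  rw [Matrix.mul_apply, Fintype.sum_sum_type, Fin.sum_univ_two]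
  rcases i with i | i
  · simp [formJ, Matrix.one_apply]
  · fin_cases i <;> simp [formJ]

lemma mul_formJ_apply (X : Mat n) (i j) : (X * formJ n) i j = X i (flip j) := by
  rw [Matrix.mul_apply, Fintype.sum_sum_type, Fin.sum_univ_two]
  rcases j with j | j
  · simp [formJ, Matrix.one_apply]
  · fin_cases j <;> simp [formJ]

lemma mem_skewJ_iff {X : Mat n} :
    X ∈ skewJ n ↔ ∀ i j, star (X (flip j) i) + X (flip i) j = 0 := by
  rw [mem_skewJ, ← Matrix.ext_iff]
  simp only [Matrix.add_apply, mul_formJ_apply, formJ_mul_apply, conjTranspose_apply,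
    Matrix.zero_apply]

lemma fromBlocks_mem_skewJ {B : Matrix (Fin (n - 1)) (Fin (n - 1)) ℂ} {p q : ℂ} :
    (fromBlocks B 0 0 !![p, 0; 0, q] : Mat n) ∈ skewJ n ↔ Bᴴ = -B ∧ q = -star p := by
  rw [mem_skewJ_iff]
  constructor
  · intro h
    refine ⟨?_, ?_⟩
    · ext i j
      simpa [eq_neg_iff_add_eq_zero] using h (Sum.inl i) (Sum.inl j)
    · simpa [eq_neg_iff_add_eq_zero, add_comm] using h (Sum.inr 0) (Sum.inr 1)
  · rintro ⟨hB, rfl⟩ (i | i) (j | j)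
    · simpa [eq_neg_iff_add_eq_zero] using congrFun (congrFun hB i) j
    · fin_cases j <;> simp
    · fin_cases i <;> simp
    · fin_cases i <;> fin_cases j <;> simp

lemma trace_eq_sum (X : Mat n) : X.trace =
    (∑ i, X (Sum.inl i) (Sum.inl i)) + (X (Sum.inr 0) (Sum.inr 0) + X (Sum.inr 1) (Sum.inr 1)) := by
  simp [trace, Fintype.sum_sum_type, Fin.sum_univ_two]

/-- `𝔰(𝔲(n-1) + 𝔲(1))` is the part of the centralizer of `𝔞` in `𝔰𝔲(n, 1)` without
`𝔞`-component. -/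
lemma mem_suu_iff {X : Mat n} :
    X ∈ suu n ↔ dg X = X ∧ X ∈ skewJ n ∧ X.trace = 0 ∧ aCoord n X = 0 := by
  have h2 : ∀ z : ℂ, (z • 1 : Matrix (Fin 2) (Fin 2) ℂ) = !![z, 0; 0, z] := by
    intro z; ext i j; fin_cases i <;> fin_cases j <;> simp
  constructor
  · rintro ⟨B, z, hB, hz, ht, rfl⟩
    rw [h2]
    refine ⟨dg_fromBlocks _ _ _, fromBlocks_mem_skewJ.2 ⟨hB, by rw [hz, neg_neg]⟩, ?_, ?_⟩
    · rw [trace_eq_sum, ← ht]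
      simp [trace, two_mul]
    · change ((fromBlocks B 0 0 !![z, 0; 0, z] : Mat n) (Sum.inr 0) (Sum.inr 0)).re = 0
      have := congrArg Complex.re hz
      simp at this ⊢
      linarith
  · rintro ⟨hd, hJ, ht, ha⟩
    have hX := dg_eq_fromBlocks hd
    rw [hX, fromBlocks_mem_skewJ] at hJ
    have hz : star (X (Sum.inr 0) (Sum.inr 0)) = -X (Sum.inr 0) (Sum.inr 0) := by
      apply Complex.ext
      · change (X (Sum.inr 0) (Sum.inr 0)).re = 0 at ha
        simp [ha]
      · simp
    refine ⟨X.toBlocks₁₁, X (Sum.inr 0) (Sum.inr 0), hJ.1, hz, ?_, ?_⟩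
    · rw [trace_eq_sum, hJ.2, hz, neg_neg] at ht
      rw [← ht]
      simp [trace, two_mul, toBlocks₁₁]
    · rw [h2]
      conv_lhs => rw [hX, hJ.2, hz, neg_neg]

lemma aCoord_A0 (n : ℕ) : aCoord n (A0 n) = 1 := by
  change (A0 n (Sum.inr 0) (Sum.inr 0)).re = 1
  simp [A0]

lemma A0_mem_skewJ (n : ℕ) : A0 n ∈ skewJ n := by
  have : A0 n = fromBlocks 0 0 0 !![1, 0; 0, -1] := rfl
  rw [this, fromBlocks_mem_skewJ]
  simp

lemma trace_A0 (n : ℕ) : (A0 n).trace = 0 := by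
  simp [trace_eq_sum, A0]

lemma conjTranspose_suu {X : Mat n} (h : X ∈ suu n) : Xᴴ = -X := by
  obtain ⟨B, z, hB, hz, ht, rfl⟩ := h
  rw [fromBlocks_conjTranspose, fromBlocks_neg, hB, conjTranspose_smul, hz]
  simp

lemma commute_formJ_suu {X : Mat n} (h : X ∈ suu n) : Commute X (formJ n) := by
  obtain ⟨B, z, hB, hz, ht, rfl⟩ := h
  rw [commute_iff_eq, formJ, fromBlocks_multiply, fromBlocks_multiply]
  simp

lemma commute_A0_suu {X : Mat n} (h : X ∈ suu n) : Commute X (A0 n) :=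
  commute_A0_iff.2 (mem_suu_iff.1 h).1

/-- `𝔫` is the strictly upper triangular part of `𝔰𝔲(n, 1)`. -/
lemma mem_nil_iff {X : Mat n} :
    X ∈ nil n ↔ X.BlockTriangular (lvl n) ∧ dg X = 0 ∧ X ∈ skewJ n := by
  constructor
  · intro hX
    have hsub : nil n ≤ skewJ n := by
      refine sup_le ?_ ((Submodule.span_singleton_le_iff_mem _ _).2 ?_)
      · rintro _ ⟨v, rfl⟩
        rw [mem_skewJ_iff]
        rintro (i | i) (j | j)
        · simp [N1]
        · fin_cases j <;> simp [N1]
        · fin_cases i <;> simp [N1]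
        · fin_cases i <;> fin_cases j <;> simp [N1]
      · rw [mem_skewJ_iff]
        rintro (i | i) (j | j)
        · simp [N2]
        · fin_cases j <;> simp [N2]
        · fin_cases i <;> simp [N2]
        · fin_cases i <;> fin_cases j <;> simp [N2]
    refine ⟨?_, ?_, hsub hX⟩ <;>
    obtain ⟨_, ⟨v, rfl⟩, _, h2, rfl⟩ := Submodule.mem_sup.1 hX <;>
    obtain ⟨b, rfl⟩ := Submodule.mem_span_singleton.1 h2
    · rintro (i | i) (j | j) hij
      · simp at hij
      · fin_cases j <;> simp [N1, N2] at hij ⊢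
      · fin_cases i <;> simp [N1, N2] at hij ⊢
      · fin_cases i <;> fin_cases j <;> simp [N1, N2] at hij ⊢
    · ext i j
      rw [dg_apply]
      rcases i with i | i <;> rcases j with j | j
      · simp [N1, N2]
      · fin_cases j <;> simp
      · fin_cases i <;> simp
      · fin_cases i <;> fin_cases j <;> simp [N1, N2]
  · rintro ⟨ht, hd, hJ⟩
    have hz : ∀ i j, lvl n i = lvl n j → X i j = 0 := fun i j h => by
      have := congrFun (congrFun hd i) j
      rwa [dg_apply, if_pos h] at this
    rw [mem_skewJ_iff] at hJ
    refine Submodule.mem_sup.2 ⟨N1 n fun i => X (Sum.inl i) (Sum.inr 1), ⟨_, rfl⟩,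
      (X (Sum.inr 0) (Sum.inr 1)).im • N2 n,
      Submodule.smul_mem _ _ (Submodule.mem_span_singleton_self _), ?_⟩
    ext i j
    rcases i with i | i <;> rcases j with j | j
    · have := hz (Sum.inl i) (Sum.inl j) rfl
      simp [N1, N2, this]
    · fin_cases j
      · have := @ht (Sum.inl i) (Sum.inr 0) (by simp)
        simp [N1, N2, this]
      · simp [N1, N2]
    · fin_cases i
      · have h := hJ (Sum.inr 1) (Sum.inl j)
        simp only [flip_inl, flip_inr_one] at h
        simpa [N1, N2] using (eq_neg_of_add_eq_zero_right h).symm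
      · have := @ht (Sum.inr 1) (Sum.inl j) (by simp)
        simp [N1, N2, this]
    · fin_cases i <;> fin_cases j
      · have := hz (Sum.inr 0) (Sum.inr 0) rfl
        simp [N1, N2, this]
      · have h := congrArg Complex.re (hJ (Sum.inr 1) (Sum.inr 1))
        simp at h
        apply Complex.ext
        · simp [N1, N2]
          linarith
        · simp [N1, N2]
      · have := @ht (Sum.inr 1) (Sum.inr 0) (by simp)
        simp [N1, N2, this]
      · have := hz (Sum.inr 1) (Sum.inr 1) rfl
        simp [N1, N2, this]

lemma dg_nil {X : Mat n} (h : X ∈ nil n) : dg X = 0 := (mem_nil_iff.1 h).2.1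

lemma trace_dg (X : Mat n) : (dg X).trace = X.trace := by
  simp [trace, dg_apply]

lemma trace_nil {X : Mat n} (h : X ∈ nil n) : X.trace = 0 := by
  rw [← trace_dg, dg_nil h, trace_zero]

lemma aCoord_dg (X : Mat n) : aCoord n (dg X) = aCoord n X := by
  change (dg X _ _).re = (X _ _).re
  rw [dg_apply, if_pos rfl]

lemma aCoord_nil {X : Mat n} (h : X ∈ nil n) : aCoord n X = 0 := by
  rw [← aCoord_dg, dg_nil h, map_zero]

/-! ### The groups `SUU`, `F` and `G` inside `SU(n, 1)` -/

lemma exp_preserves_formJ {X : Mat n} (hX : X ∈ skewJ n) :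
    (exp X)ᴴ * formJ n * exp X = formJ n := by
  have h : SemiconjBy (formJ n) X (-Xᴴ) := by
    rw [mem_skewJ] at hX
    rw [SemiconjBy, neg_mul, eq_neg_iff_add_eq_zero, add_comm, hX]
  have h' : formJ n * exp X = exp (-Xᴴ) * formJ n := h.exp_right
  rw [Matrix.mul_assoc, h', ← Matrix.mul_assoc, ← exp_conjTranspose,
    ← Matrix.exp_add_of_commute _ _ (Commute.refl Xᴴ).neg_right, add_neg_cancel, NormedSpace.exp_zero, Matrix.one_mul]

lemma mem_SUU_of {g : SLn n} (hd : dg (mat g) = mat g) (hu : (mat g)ᴴ * mat g = 1)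
    (hJ : Commute (mat g) (formJ n)) : g ∈ SUU n := by
  have hg := dg_eq_fromBlocks hd
  have hpq : mat g (Sum.inr 0) (Sum.inr 0) = mat g (Sum.inr 1) (Sum.inr 1) := by
    have := congrFun (congrFun hJ.eq (Sum.inr 0)) (Sum.inr 1)
    rwa [mul_formJ_apply, formJ_mul_apply] at this
  rw [hg, fromBlocks_conjTranspose, fromBlocks_multiply, ← fromBlocks_one, fromBlocks_inj] at hu
  refine ⟨(mat g).toBlocks₁₁, ?_, mat g (Sum.inr 0) (Sum.inr 0), ?_, ?_⟩
  · rw [mem_unitaryGroup_iff']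
    simpa [star_eq_conjTranspose] using hu.1
  · have := congrFun (congrFun hu.2.2.2 0) 0
    rw [Unitary.mem_iff_star_mul_self]
    simpa [Matrix.mul_apply, Fin.sum_univ_two] using this
  · conv_lhs => rw [hg]
    rw [← hpq]
    congr 1
    ext i j; fin_cases i <;> fin_cases j <;> simp

section SUU

variable {u : SLn n} (hu : u ∈ SUU n)
include hu

lemma dg_SUU : dg (mat u) = mat u := by
  obtain ⟨B, -, z, -, h⟩ := hu
  have : (z • 1 : Matrix (Fin 2) (Fin 2) ℂ) = !![z, 0; 0, z] := by
    ext i j; fin_cases i <;> fin_cases j <;> simp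
  rw [h, this, dg_fromBlocks]

lemma conjTranspose_mul_SUU : (mat u)ᴴ * mat u = 1 := by
  obtain ⟨B, hB, z, hz, h⟩ := hu
  have hB' : Bᴴ * B = 1 := mem_unitaryGroup_iff'.1 hB
  have hz' := Unitary.star_mul_self_of_mem hz
  rw [h, fromBlocks_conjTranspose, fromBlocks_multiply, ← fromBlocks_one]
  congr 1
  · simp [hB']
  · simp
  · simp
  · rw [conjTranspose_smul, smul_mul_smul_comm, hz']
    simp

lemma commute_formJ_SUU : Commute (mat u) (formJ n) := by
  obtain ⟨B, -, z, -, h⟩ := hu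
  rw [commute_iff_eq, h, formJ, fromBlocks_multiply, fromBlocks_multiply]
  simp

lemma mat_inv_SUU : mat u⁻¹ = (mat u)ᴴ := by
  have h := conjTranspose_mul_SUU hu
  calc mat u⁻¹ = ((mat u)ᴴ * mat u) * mat u⁻¹ := by rw [h, Matrix.one_mul]
    _ = (mat u)ᴴ := by rw [Matrix.mul_assoc, mat_mul_mat_inv, Matrix.mul_one]

lemma preserves_formJ_SUU : (mat u)ᴴ * formJ n * mat u = formJ n := by
  rw [Matrix.mul_assoc, ← (commute_formJ_SUU hu).eq, ← Matrix.mul_assoc, conjTranspose_mul_SUU hu,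
    Matrix.one_mul]

lemma norm_apply_SUU : ‖mat u (Sum.inr 0) (Sum.inr 0)‖ = 1 := by
  obtain ⟨B, hB, z, hz, h⟩ := hu
  rw [h]
  simpa using CStarRing.norm_of_mem_unitary hz

end SUU

lemma exp_mem_SUU {X : Mat n} (hX : X ∈ suu n) {g : SLn n} (hg : mat g = exp X) : g ∈ SUU n := by
  refine mem_SUU_of ?_ ?_ ?_
  · rw [← commute_A0_iff, hg]
    exact (commute_A0_suu hX).exp_left
  · rw [hg, ← exp_conjTranspose, conjTranspose_suu hX,
      ← Matrix.exp_add_of_commute _ _ (Commute.refl X).neg_left, neg_add_cancel, NormedSpace.exp_zero]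
  · rw [hg]
    exact (commute_formJ_suu hX).exp_left

lemma exp_smul_A0 (a : ℝ) : exp (a • A0 n) =
    diagonal (Sum.elim 1 ![(Real.exp a : ℂ), (Real.exp (-a) : ℂ)]) := by
  have h : a • A0 n = diagonal (Sum.elim 0 ![(a : ℂ), -a]) := by
    rw [A0_eq_diagonal, ← diagonal_smul]
    congr 1
    ext (i | i)
    · simp
    · fin_cases i <;> simp
  rw [h, exp_diagonal]
  congr 1
  ext (i | i)
  · simp [Pi.coe_exp]
  · fin_cases i <;> simp [Pi.coe_exp, ← Complex.exp_eq_exp_ℂ]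

lemma norm_apply_of_eq_mul_exp {f u : SLn n} (hu : u ∈ SUU n) {a : ℝ}
    (h : mat f = mat u * exp (a • A0 n)) : ‖mat f (Sum.inr 0) (Sum.inr 0)‖ = Real.exp a := by
  rw [h, exp_smul_A0, mul_diagonal, norm_mul, norm_apply_SUU hu]
  simp [Complex.norm_exp]

section F

variable {F : Subgroup (SLn n)} (hF : IsAdmissible F)
include hF

lemma dg_F {f : SLn n} (hf : f ∈ F) : dg (mat f) = mat f := by
  obtain ⟨u, hu, a, h⟩ := hF.le f hf
  rw [← commute_A0_iff, h]
  exact (commute_A0_iff.2 (dg_SUU hu)).mul_left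
    (((Commute.refl (A0 n)).smul_left a).exp_left)

lemma preserves_formJ_F {f : SLn n} (hf : f ∈ F) : (mat f)ᴴ * formJ n * mat f = formJ n := by
  obtain ⟨u, hu, a, h⟩ := hF.le f hf
  rw [h, conjTranspose_mul]
  have : ∀ E U : Mat n, Eᴴ * Uᴴ * formJ n * (U * E) = Eᴴ * (Uᴴ * formJ n * U) * E := by
    intro E U; noncomm_ring
  rw [this, preserves_formJ_SUU hu]
  exact exp_preserves_formJ (Submodule.smul_mem _ _ (A0_mem_skewJ n))

end F

lemma lieAlg_le_skewJ {K : Subgroup (SLn n)}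
    (h : ∀ g ∈ K, (mat g)ᴴ * formJ n * mat g = formJ n) : lieAlg K ≤ skewJ n := by
  intro X hX
  obtain ⟨γ, hK, hγ⟩ := mem_lieAlg_iff.1 hX
  have h1 := hasDerivAt_matrix.2 hγ.hasDerivAt
  have h2 : HasDerivAt (fun t => (mat (γ t))ᴴ) Xᴴ 0 :=
    hasDerivAt_matrix.2 fun i j => by
      simpa using (hγ.hasDerivAt j i).star
  have h3 := (h2.mul_const (formJ n)).mul h1
  have h4 : HasDerivAt (fun t => (mat (γ t))ᴴ * formJ n * mat (γ t)) 0 0 := by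
    simp only [h _ (hK _)]
    exact hasDerivAt_const _ _
  have h5 := h3.unique h4
  rw [mem_skewJ]
  simpa [hγ.zero] using h5

lemma dg_of_mem_lieAlg {K : Subgroup (SLn n)} (h : ∀ g ∈ K, dg (mat g) = mat g) {X : Mat n}
    (hX : X ∈ lieAlg K) : dg X = X := by
  obtain ⟨γ, hK, hγ⟩ := mem_lieAlg_iff.1 hX
  ext i j
  rw [dg_apply]
  split_ifs with hij
  · rfl
  · refine HasDerivAt.unique (hasDerivAt_const (0 : ℝ) (0 : ℂ)) ?_
    have h0 : (fun t => mat (γ t) i j) = fun _ => 0 := funext fun t => by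
      rw [← h _ (hK t), dg_apply, if_neg hij]
    exact h0 ▸ hγ.hasDerivAt i j

section F

variable {F : Subgroup (SLn n)} (hF : IsAdmissible F)
include hF

lemma lieAlg_F_le_skewJ : lieAlg F ≤ skewJ n :=
  lieAlg_le_skewJ fun _ hf => preserves_formJ_F hF hf

lemma dg_lieAlg_F {X : Mat n} (hX : X ∈ lieAlg F) : dg X = X :=
  dg_of_mem_lieAlg (fun _ hf => dg_F hF hf) hX

lemma mem_suu_of_mem_lieAlg_F {X : Mat n} (hX : X ∈ lieAlg F) (ha : aCoord n X = 0) :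
    X ∈ suu n :=
  mem_suu_iff.2 ⟨dg_lieAlg_F hF hX, lieAlg_F_le_skewJ hF hX, trace_eq_zero_of_mem_lieAlg hX, ha⟩

lemma sub_A0_mem_suu {X : Mat n} (hX : X ∈ lieAlg F) (ha : aCoord n X = 1) :
    X - A0 n ∈ suu n := by
  refine mem_suu_iff.2 ⟨?_, sub_mem (lieAlg_F_le_skewJ hF hX) (A0_mem_skewJ n), ?_, ?_⟩
  · rw [map_sub, dg_lieAlg_F hF hX, commute_A0_iff.1 (Commute.refl _)]
  · rw [trace_sub, trace_eq_zero_of_mem_lieAlg hX, trace_A0, sub_zero]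
  · rw [map_sub, ha, aCoord_A0, sub_self]

/-- `𝔥` is the kernel of the projection of `𝔣_r` to `𝔞`. -/
lemma mem_lieAlg_H_iff {X : Mat n} : X ∈ lieAlg (H F) ↔ X ∈ lieAlg F ∧ aCoord n X = 0 := by
  constructor
  · intro hX
    refine ⟨lieAlg_mono inf_le_left hX, ?_⟩
    obtain ⟨γ, hK, hγ⟩ := mem_lieAlg_iff.1 hX
    have h1 : X (Sum.inr 0) (Sum.inr 0) = X (Sum.inr 1) (Sum.inr 1) := by
      have h0 : (fun t => mat (γ t) (Sum.inr 0) (Sum.inr 0)) =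
          fun t => mat (γ t) (Sum.inr 1) (Sum.inr 1) := funext fun t => by
        have := congrFun (congrFun (commute_formJ_SUU (hK t).2).eq (Sum.inr 0)) (Sum.inr 1)
        rwa [mul_formJ_apply, formJ_mul_apply] at this
      exact (h0 ▸ hγ.hasDerivAt (Sum.inr 0) (Sum.inr 0)).unique (hγ.hasDerivAt _ _)
    have h2 := mem_skewJ_iff.1 (lieAlg_F_le_skewJ hF (lieAlg_mono inf_le_left hX))
      (Sum.inr 1) (Sum.inr 0)
    have h3 := congrArg Complex.re h2
    change (X (Sum.inr 0) (Sum.inr 0)).re = 0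
    simp [← h1] at h3
    linarith
  · rintro ⟨hX, ha⟩
    have hs := mem_suu_of_mem_lieAlg_F hF hX ha
    exact mem_lieAlg_of_exp (trace_eq_zero_of_mem_lieAlg hX) fun t g hg =>
      ⟨exp_mem_of_mem_lieAlg hF.isClosed (Submodule.smul_mem _ t hX) hg,
        exp_mem_SUU (Submodule.smul_mem _ t hs) hg⟩

lemma exp_mem_H {X : Mat n} (hX : X ∈ lieAlg (H F)) {g : SLn n} (hg : mat g = exp X) :
    g ∈ H F :=
  ⟨exp_mem_of_mem_lieAlg hF.isClosed ((mem_lieAlg_H_iff hF).1 hX).1 hg,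
    exp_mem_SUU (mem_suu_of_mem_lieAlg_F hF ((mem_lieAlg_H_iff hF).1 hX).1
      ((mem_lieAlg_H_iff hF).1 hX).2) hg⟩

lemma lieAlg_H_le_suu : lieAlg (H F) ≤ suu n := fun _ hX =>
  mem_suu_of_mem_lieAlg_F hF ((mem_lieAlg_H_iff hF).1 hX).1 ((mem_lieAlg_H_iff hF).1 hX).2

lemma conj_mem_nil {f : SLn n} (hf : f ∈ F) {X : Mat n} (hX : X ∈ nil n) :
    mat f * X * mat f⁻¹ ∈ nil n := by
  obtain ⟨ht, hd, hJ⟩ := mem_nil_iff.1 hX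
  have ht1 : (mat f).BlockTriangular (lvl n) := dg_F hF hf ▸ blockTriangular_dg _
  have ht2 : (mat f⁻¹).BlockTriangular (lvl n) := dg_F hF (inv_mem hf) ▸ blockTriangular_dg _
  refine mem_nil_iff.2 ⟨(ht1.mul ht).mul ht2, ?_, ?_⟩
  · rw [dg_mul (ht1.mul ht) ht2, dg_mul ht1 ht, hd, Matrix.mul_zero, Matrix.zero_mul]
  · rw [mem_skewJ] at hJ ⊢
    have h1 := preserves_formJ_F hF (inv_mem hf)
    have h2 : formJ n * mat f = (mat f⁻¹)ᴴ * formJ n := by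
      conv_lhs => rw [← h1]
      rw [Matrix.mul_assoc, mat_inv_mul_mat, Matrix.mul_one]
    have h3 : (mat f)ᴴ * formJ n = formJ n * mat f⁻¹ := by
      conv_rhs => rw [← preserves_formJ_F hF hf]
      rw [Matrix.mul_assoc, mat_mul_mat_inv, Matrix.mul_one]
    rw [conjTranspose_mul, conjTranspose_mul]
    calc _ = (mat f⁻¹)ᴴ * Xᴴ * ((mat f)ᴴ * formJ n) + (formJ n * mat f) * X * mat f⁻¹ := by
          noncomm_ring
      _ = (mat f⁻¹)ᴴ * (Xᴴ * formJ n + formJ n * X) * mat f⁻¹ := by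
          rw [h2, h3]; noncomm_ring
      _ = 0 := by rw [hJ, Matrix.mul_zero, Matrix.zero_mul]

end F

/-! ### The Lie algebra of `G` -/

lemma conj_mem_lieAlg_self {F : Subgroup (SLn n)} {g : SLn n} (hg : g ∈ F) {X : Mat n} (hX : X ∈ lieAlg (F)) :
    mat g * X * mat g⁻¹ ∈ lieAlg (F) :=
  conj_mem_lieAlg (fun _ hk => mul_mem (mul_mem hg hk) (inv_mem hg)) hX

lemma blockTriangular_mat_inv {g : SLn n} (h : (mat g).BlockTriangular (lvl n)) :
    (mat g⁻¹).BlockTriangular (lvl n) := by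
  have : mat g⁻¹ = (mat g)⁻¹ := (inv_eq_left_inv (mat_inv_mul_mat g)).symm
  have : Invertible (mat g) := ⟨mat g⁻¹, mat_inv_mul_mat g, mat_mul_mat_inv g⟩
  rw [‹mat g⁻¹ = _›]
  exact blockTriangular_inv_of_blockTriangular h

lemma dg_exp_nil {X : Mat n} (hX : X ∈ nil n) : dg (exp X) = 1 := by
  obtain ⟨ht, hd, -⟩ := mem_nil_iff.1 hX
  have hts : ∀ t : ℝ, (t • X).BlockTriangular (lvl n) := fun t i j h => by simp [ht h]
  have h : ∀ t : ℝ, HasDerivAt (fun t : ℝ => dg (exp (t • X))) 0 t := by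
    intro t
    have h0 : dg (exp (t • X) * X) = 0 := by
      rw [dg_mul (hts t).exp ht, hd, Matrix.mul_zero]
    rw [← h0, hasDerivAt_matrix]
    intro i j
    simp only [dg_apply]
    split_ifs
    · exact hasDerivAt_exp_entry X t i j
    · exact hasDerivAt_const _ _
  have := is_const_of_deriv_eq_zero (fun t => (h t).differentiableAt) (fun t => (h t).deriv) 1 0
  simpa using this

/-- The subgroup of `SU(n, 1)` of the block-triangular matrices whose block-diagonal part lies in
`F`. -/
def parabolic (F : Subgroup (SLn n)) : Subgroup (SLn n) where
  carrier := {g | (mat g).BlockTriangular (lvl n) ∧ (mat g)ᴴ * formJ n * mat g = formJ n ∧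
    ∃ f ∈ F, mat f = dg (mat g)}
  one_mem' := ⟨by simpa using blockTriangular_one, by simp, 1, one_mem _, by simp⟩
  mul_mem' := by
    rintro g g' ⟨ht, hJ, f, hf, h⟩ ⟨ht', hJ', f', hf', h'⟩
    refine ⟨by simpa using ht.mul ht', ?_, f * f', mul_mem hf hf', ?_⟩
    · rw [map_mul, conjTranspose_mul]
      calc _ = (mat g')ᴴ * ((mat g)ᴴ * formJ n * mat g) * mat g' := by noncomm_ring
        _ = _ := by rw [hJ, hJ']
    · rw [map_mul, map_mul, dg_mul ht ht', h, h']
  inv_mem' := by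
    rintro g ⟨ht, hJ, f, hf, h⟩
    refine ⟨blockTriangular_mat_inv ht, ?_, f⁻¹, inv_mem hf, ?_⟩
    · conv_lhs => rw [← hJ]
      have : (mat g⁻¹)ᴴ * (mat g)ᴴ = 1 := by
        rw [← conjTranspose_mul, mat_mul_mat_inv, conjTranspose_one]
      calc _ = ((mat g⁻¹)ᴴ * (mat g)ᴴ) * formJ n * (mat g * mat g⁻¹) := by noncomm_ring
        _ = _ := by rw [this, mat_mul_mat_inv, Matrix.one_mul, Matrix.mul_one]
    · have h1 : dg (mat g) * dg (mat g⁻¹) = 1 := by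
        rw [← dg_mul ht (blockTriangular_mat_inv ht), mat_mul_mat_inv, dg_one]
      rw [← h] at h1
      calc mat f⁻¹ = mat f⁻¹ * (mat f * dg (mat g⁻¹)) := by rw [h1, Matrix.mul_one]
        _ = dg (mat g⁻¹) := by rw [← Matrix.mul_assoc, mat_inv_mul_mat, Matrix.one_mul]

lemma exp_mem_Nil {X : Mat n} (hX : X ∈ nil n) {g : SLn n} (hg : mat g = exp X) : g ∈ Nil n :=
  Subgroup.subset_closure ⟨X, hX, hg⟩

lemma F_le_G (F : Subgroup (SLn n)) : F ≤ G F := le_sup_left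
lemma H_le_G (F : Subgroup (SLn n)) : H F ≤ G F := inf_le_left.trans le_sup_left
lemma Nil_le_G (F : Subgroup (SLn n)) : Nil n ≤ G F := le_sup_right

section F

variable {F : Subgroup (SLn n)} (hF : IsAdmissible F)
include hF

lemma G_le_parabolic : G F ≤ parabolic F := by
  refine sup_le ?_ ((Subgroup.closure_le _).2 ?_)
  · intro f hf
    exact ⟨dg_F hF hf ▸ blockTriangular_dg _, preserves_formJ_F hF hf, f, hf, (dg_F hF hf).symm⟩
  · rintro g ⟨X, hX, hg⟩
    obtain ⟨ht, -, hJ⟩ := mem_nil_iff.1 hX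
    refine ⟨?_, ?_, 1, one_mem _, ?_⟩
    · rw [hg]; exact ht.exp
    · rw [hg]; exact exp_preserves_formJ hJ
    · rw [hg, dg_exp_nil hX, map_one]

lemma lieAlg_G : lieAlg (G F) = lieAlg F ⊔ nil n := by
  refine le_antisymm ?_ (sup_le (lieAlg_mono (F_le_G F)) ?_)
  · intro X hX
    have hXJ : X ∈ skewJ n := lieAlg_le_skewJ (fun g hg => (G_le_parabolic hF hg).2.1) hX
    obtain ⟨γ, hK, hγ⟩ := mem_lieAlg_iff.1 hX
    have hXt : X.BlockTriangular (lvl n) := by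
      intro i j hij
      have h0 : (fun t => mat (γ t) i j) = fun _ => 0 := funext fun t =>
        (G_le_parabolic hF (hK t)).1 hij
      exact (h0 ▸ hγ.hasDerivAt i j).unique (hasDerivAt_const _ _)
    choose f hfF hf using fun t => (G_le_parabolic hF (hK t)).2.2
    have hdX : dg X ∈ lieAlg F := by
      refine mem_lieAlg_iff.2 ⟨f, hfF, mat_injective ?_, fun i j => ?_, fun i j => ?_⟩
      · rw [hf, hγ.zero, map_one, dg_one]
      · simp only [hf, dg_apply]
        split_ifs
        · exact hγ.contDiff i j
        · exact contDiff_const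
      · simp only [hf, dg_apply]
        split_ifs
        · exact hγ.hasDerivAt i j
        · exact hasDerivAt_const _ _
    rw [← add_sub_cancel (dg X) X]
    refine Submodule.add_mem_sup hdX (mem_nil_iff.2 ⟨hXt.sub (blockTriangular_dg X), ?_, ?_⟩)
    · rw [map_sub, dg_dg, sub_self]
    · exact sub_mem hXJ (lieAlg_F_le_skewJ hF hdX)
  · intro X hX
    exact mem_lieAlg_of_exp (trace_nil hX) fun t g hg =>
      Nil_le_G F (exp_mem_Nil (Submodule.smul_mem _ t hX) hg)

end F

/-! ### A tangent vector of `F` that projects onto `𝔞` -/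

section F

variable {F : Subgroup (SLn n)} (hF : IsAdmissible F)
include hF

lemma norm_apply_mul {f g : SLn n} (hf : f ∈ F) :
    ‖mat (f * g) (Sum.inr 0) (Sum.inr 0)‖ =
      ‖mat f (Sum.inr 0) (Sum.inr 0)‖ * ‖mat g (Sum.inr 0) (Sum.inr 0)‖ := by
  rw [map_mul, dg_eq_fromBlocks (dg_F hF hf), ← norm_mul]
  congr 1
  rw [Matrix.mul_apply, Fintype.sum_sum_type, Fin.sum_univ_two]
  simp

lemma norm_apply_le {f : SLn n} (hf : f ∈ F) {a : ℝ} (ha : 0 ≤ a) {b : ℝ} (hb : |b| ≤ a)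
    (h : ‖mat f (Sum.inr 0) (Sum.inr 0)‖ = Real.exp b) (i j) : ‖mat f i j‖ ≤ Real.exp a := by
  obtain ⟨u, hu, c, hc⟩ := hF.le f hf
  have hcb : c = b := Real.exp_injective ((norm_apply_of_eq_mul_exp hu hc).symm.trans h)
  subst hcb
  have h1 : ‖mat u i j‖ ≤ 1 := entry_norm_bound_of_unitary
    (mem_unitaryGroup_iff'.2 (conjTranspose_mul_SUU hu)) i j
  rw [hc, exp_smul_A0, mul_diagonal, norm_mul]
  obtain ⟨hb1, hb2⟩ := abs_le.1 hb
  have h2 : ‖(Sum.elim 1 ![(Real.exp c : ℂ), (Real.exp (-c) : ℂ)] : Fin (n - 1) ⊕ Fin 2 → ℂ) j‖ ≤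
      Real.exp a := by
    rcases j with j | j
    · simpa using ha
    · fin_cases j
      · simpa [Complex.norm_exp] using hb2
      · simp [Complex.norm_exp]
        linarith
  calc _ ≤ 1 * Real.exp a := by gcongr
    _ = _ := one_mul _

/-- Among the elements of `F` over a fixed point of `exp 𝔞` the nearest ones to the identity tend to
the identity as the base point does, along a subsequence. -/
lemma exists_minimizing_seq : ∃ f : ℕ → SLn n, (∀ k, f k ∈ F) ∧
    (∀ k, mat (f k) ≠ 1) ∧ Tendsto (fun k => mat (f k)) atTop (𝓝 1) ∧
    ∀ k, ∀ h ∈ H F, ‖mat (f k) - 1‖ ≤ ‖mat h * mat (f k) - 1‖ := by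
  obtain ⟨f₀, hf₀, u, hu, a, ha, h₀⟩ := hF.proj_nontrivial
  set p : SLn n → ℝ := fun g => ‖mat g (Sum.inr 0) (Sum.inr 0)‖ with hp
  have hcont : Continuous fun M : Mat n => ‖M (Sum.inr 0) (Sum.inr 0)‖ :=
    (continuous_id.matrix_elem _ _).norm
  have hpc : Continuous p := hcont.comp continuous_mat
  set s : ℕ → ℝ := fun k => (1 / ((k : ℝ) + 1)) * a with hs
  have hs0 : Tendsto s atTop (𝓝 0) := by
    simpa [hs] using (tendsto_one_div_add_atTop_nhds_zero_nat (𝕜 := ℝ)).mul_const a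
  have hsa : ∀ k, |s k| ≤ |a| := by
    intro k
    rw [hs, abs_mul, abs_of_nonneg (by positivity)]
    have : 1 / ((k : ℝ) + 1) ≤ 1 := by
      rw [div_le_one (by positivity)]
      linarith [(Nat.cast_nonneg k : (0 : ℝ) ≤ k)]
    nlinarith [abs_nonneg a]
  -- By connectedness, `F` meets the fibre over every point between `1` and the image of `f₀`.
  have hex : ∀ k, ∃ f ∈ F, p f = Real.exp (s k) := by
    intro k
    have hc : (p '' (F : Set (SLn n))).OrdConnected :=
      (hF.isConnected.isPreconnected.image p hpc.continuousOn).ordConnected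
    have h1 : (1 : ℝ) ∈ p '' (F : Set (SLn n)) := ⟨1, one_mem F, by simp [hp]⟩
    have h2 : Real.exp a ∈ p '' (F : Set (SLn n)) :=
      ⟨f₀, hf₀, norm_apply_of_eq_mul_exp hu h₀⟩
    refine hc.uIcc_subset h1 h2 ?_
    have h3 : 0 ≤ 1 / ((k : ℝ) + 1) := by positivity
    have h4 : 1 / ((k : ℝ) + 1) ≤ 1 := by
      rw [div_le_one (by positivity)]
      linarith [(Nat.cast_nonneg k : (0 : ℝ) ≤ k)]
    rw [Set.mem_uIcc]
    rcases le_total 0 a with h | h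
    · refine Or.inl ⟨Real.one_le_exp (mul_nonneg h3 h), Real.exp_le_exp.2 ?_⟩
      exact mul_le_of_le_one_left h h4
    · refine Or.inr ⟨Real.exp_le_exp.2 ?_, Real.exp_le_one_iff.2 (mul_nonpos_of_nonneg_of_nonpos h3 h)⟩
      simp only [hs]
      nlinarith
  set C : Set (Mat n) := Set.univ.pi fun _ => Set.univ.pi fun _ =>
    Metric.closedBall (0 : ℂ) (Real.exp |a|) with hC
  have hCc : IsCompact C :=
    isCompact_univ_pi fun _ => isCompact_univ_pi fun _ => isCompact_closedBall _ _
  have hmemC : ∀ k, ∀ f ∈ F, p f = Real.exp (s k) → mat f ∈ C := by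
    intro k f hf h i _ j _
    rw [mem_closedBall_zero_iff]
    exact norm_apply_le hF hf (abs_nonneg a) (hsa k) h i j
  have hmin : ∀ k, ∃ f ∈ F, p f = Real.exp (s k) ∧
      ∀ g ∈ F, p g = Real.exp (s k) → ‖mat f - 1‖ ≤ ‖mat g - 1‖ := by
    intro k
    have hc : IsCompact (C ∩ (mat '' (F : Set (SLn n)) ∩
        {M : Mat n | ‖M (Sum.inr 0) (Sum.inr 0)‖ = Real.exp (s k)})) :=
      hCc.inter_right ((isClosed_image_mat hF.isClosed).inter
        (isClosed_eq hcont continuous_const))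
    obtain ⟨g, hg, hgp⟩ := hex k
    obtain ⟨_, ⟨-, ⟨f, hf, rfl⟩, hfp⟩, hfm⟩ := hc.exists_isMinOn
      ⟨mat g, hmemC k g hg hgp, ⟨g, hg, rfl⟩, hgp⟩
      (f := fun M : Mat n => ‖M - 1‖) (by fun_prop)
    exact ⟨f, hf, hfp, fun g hg hgp => hfm ⟨hmemC k g hg hgp, ⟨g, hg, rfl⟩, hgp⟩⟩
  choose f hf hfp hfm using hmin
  have : FirstCountableTopology (Mat n) := inferInstanceAs
    (FirstCountableTopology (Fin (n - 1) ⊕ Fin 2 → Fin (n - 1) ⊕ Fin 2 → ℂ))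
  obtain ⟨M, -, φ, hφ, hM⟩ := hCc.tendsto_subseq fun k => hmemC k (f k) (hf k) (hfp k)
  obtain ⟨g, hg, rfl⟩ : M ∈ mat '' (F : Set (SLn n)) :=
    (isClosed_image_mat hF.isClosed).mem_of_tendsto hM
      (Eventually.of_forall fun k => ⟨f (φ k), hf _, rfl⟩)
  have hgp : p g = 1 := by
    have h1 : Tendsto (fun k => p (f (φ k))) atTop (𝓝 (p g)) := (hcont.tendsto _).comp hM
    have h2 : Tendsto (fun k => p (f (φ k))) atTop (𝓝 (Real.exp 0)) := by
      simp only [hfp]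
      exact (Real.continuous_exp.tendsto 0).comp (hs0.comp hφ.tendsto_atTop)
    simpa using tendsto_nhds_unique h1 h2
  have hgi : p g⁻¹ = 1 := by
    have := norm_apply_mul hF hg (g := g⁻¹)
    rw [mul_inv_cancel, map_one] at this
    simp only [hp] at hgp ⊢
    rw [hgp] at this
    simpa using this.symm
  have hlim : Tendsto (fun k => mat (f (φ k))) atTop (𝓝 1) := by
    have h1 : Tendsto (fun k => mat g⁻¹ * mat (f (φ k)) - 1) atTop (𝓝 0) := by
      have := (hM.const_mul (mat g⁻¹)).sub_const 1
      rwa [mat_inv_mul_mat, sub_self] at this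
    refine tendsto_iff_norm_sub_tendsto_zero.2 (squeeze_zero (fun _ => norm_nonneg _) (fun k => ?_)
      (tendsto_zero_iff_norm_tendsto_zero.1 h1))
    rw [← map_mul]
    refine hfm _ _ (mul_mem (inv_mem hg) (hf _)) ?_
    rw [← hfp (φ k)]
    exact (norm_apply_mul hF (inv_mem hg)).trans (by
      simp only [hp] at hgi
      rw [hgi, one_mul])
  refine ⟨fun k => f (φ k), fun k => hf _, fun k h1 => ?_, hlim, fun k h hh => ?_⟩
  · have h2 := hfp (φ k)
    simp only [hp, h1] at h2
    rw [Matrix.one_apply_eq, norm_one, eq_comm, Real.exp_eq_one_iff] at h2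
    have h3 : 1 / ((φ k : ℝ) + 1) ≠ 0 := by positivity
    exact mul_ne_zero h3 ha h2
  · rw [← map_mul]
    refine hfm _ _ (mul_mem hh.1 (hf _)) ?_
    rw [← hfp (φ k)]
    exact (norm_apply_mul hF hh.1).trans (by rw [norm_apply_SUU hh.2, one_mul])

/-- The projection of `𝔣_r` to `𝔞` is not zero. A limit `X` of the directions in which a minimizing
sequence approaches the identity is tangent to `F`; if it were tangent to `H`, then moving along
`-X` inside `H` would bring the sequence nearer to the identity. -/
lemma exists_mem_lieAlg_aCoord_ne_zero : ∃ X ∈ lieAlg F, aCoord n X ≠ 0 := by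
  obtain ⟨f, hf, hne, hlim, hmin⟩ := exists_minimizing_seq hF
  set ε : ℕ → ℝ := fun k => ‖mat (f k) - 1‖ with hε
  have hεpos : ∀ k, 0 < ε k := fun k => norm_pos_iff.2 (sub_ne_zero.2 (hne k))
  have hε0 : Tendsto ε atTop (𝓝 0) := tendsto_iff_norm_sub_tendsto_zero.1 hlim
  set Y : ℕ → Mat n := fun k => (ε k)⁻¹ • (mat (f k) - 1) with hY
  have hYs : ∀ k, Y k ∈ Metric.sphere (0 : Mat n) 1 := by
    intro k
    rw [mem_sphere_zero_iff_norm, hY, norm_smul, norm_inv, Real.norm_of_nonneg (hεpos k).le]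
    exact inv_mul_cancel₀ (hεpos k).ne'
  have : ProperSpace (Mat n) := FiniteDimensional.proper_real (Mat n)
  obtain ⟨X, -, φ, hφ, hX⟩ := (isCompact_sphere (0 : Mat n) 1).tendsto_subseq hYs
  have hεφ : Tendsto (fun k => ε (φ k)) atTop (𝓝 0) := hε0.comp hφ.tendsto_atTop
  have hinv : Tendsto (fun k => (ε (φ k))⁻¹) atTop atTop :=
    (tendsto_nhdsWithin_iff.2 ⟨hεφ, Eventually.of_forall fun k => hεpos _⟩).inv_tendsto_nhdsGT_zero
  have hXF : X ∈ lieAlg F := by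
    refine mem_lieAlg_of_exists_exp fun t ht => ?_
    rcases ht.eq_or_lt with rfl | ht
    · exact ⟨1, one_mem _, by simp⟩
    refine exists_mat_eq_exp_of_tendsto hF.isClosed (g := fun k => f (φ k))
      (fun k => hf _) (k := fun k => ⌊t * (ε (φ k))⁻¹⌋₊)
      (tendsto_nat_floor_atTop.comp (hinv.const_mul_atTop ht)) ?_
    refine (((tendsto_nat_floor_mul_div_atTop ht.le).comp hinv).smul hX).congr fun k => ?_
    simp only [Function.comp_apply, hY, smul_smul, div_inv_eq_mul]
    rw [mul_assoc, mul_inv_cancel₀ (hεpos _).ne', mul_one]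
  refine ⟨X, hXF, fun ha => ?_⟩
  have hXH : X ∈ lieAlg (H F) := (mem_lieAlg_H_iff hF).2 ⟨hXF, ha⟩
  have h1 : ∀ k, 1 ≤ ‖(ε (φ k))⁻¹ • (exp (-ε (φ k) • X) * mat (f (φ k)) - 1)‖ := by
    intro k
    have h2 := hmin (φ k) (expSL (-ε (φ k) • X)
      (by rw [trace_smul, trace_eq_zero_of_mem_lieAlg hXH, smul_zero]))
      (exp_mem_H hF (Submodule.smul_mem _ _ hXH) rfl)
    rw [norm_smul, norm_inv, Real.norm_of_nonneg (hεpos _).le, inv_mul_eq_div,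
      le_div_iff₀ (hεpos _), one_mul]
    exact h2
  have h2 : Tendsto (fun k => (ε (φ k))⁻¹ • (exp (-ε (φ k) • X) * mat (f (φ k)) - 1)) atTop
      (𝓝 0) := by
    have h0 : HasDerivAt (fun t : ℝ => exp (-t • X)) (-X) 0 := by
      have := hasDerivAt_exp_smul_const (𝕂 := ℝ) (-X) 0
      simp only [zero_smul, smul_neg, neg_zero, NormedSpace.exp_zero, one_mul] at this
      simp only [neg_smul]
      exact this
    have h3 := tendsto_slope_seq h0 hεφ (Eventually.of_forall fun k => (hεpos _).ne')
    have h4 : Tendsto (fun k => exp (-ε (φ k) • X)) atTop (𝓝 1) := by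
      have := (h0.continuousAt.tendsto).comp hεφ
      simp only [neg_zero, zero_smul, NormedSpace.exp_zero] at this
      exact this
    have h5 := h3.add (h4.mul hX)
    rw [Matrix.one_mul, neg_add_cancel] at h5
    refine h5.congr fun k => ?_
    simp only [Function.comp_apply, hY, neg_zero, zero_smul, NormedSpace.exp_zero]
    rw [mul_smul_comm, ← smul_add]
    congr 1
    noncomm_ring
  have h3 := ge_of_tendsto h2.norm (Eventually.of_forall h1)
  rw [norm_zero] at h3
  exact absurd h3 (by norm_num)

end F

/-! ### The inner product -/

lemma kForm_eq_sum (X Y : Mat n) : kForm X Y = ∑ i, ∑ j, (star (X j i) * Y j i).re := by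
  simp [kForm, trace, Matrix.mul_apply]

lemma kForm_comm (X Y : Mat n) : kForm X Y = kForm Y X := by
  rw [kForm_eq_sum, kForm_eq_sum]
  refine Finset.sum_congr rfl fun i _ => Finset.sum_congr rfl fun j _ => ?_
  simp
  ring

lemma kForm_self_eq_zero {X : Mat n} (h : kForm X X = 0) : X = 0 := by
  have h0 : ∀ z : ℂ, (star z * z).re = Complex.normSq z := fun z => by
    simp [Complex.normSq_apply]
  simp only [kForm_eq_sum, h0] at h
  rw [Finset.sum_eq_zero_iff_of_nonneg fun i _ => Finset.sum_nonneg fun j _ =>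
    Complex.normSq_nonneg _] at h
  ext i j
  have h1 := h j (Finset.mem_univ _)
  rw [Finset.sum_eq_zero_iff_of_nonneg fun j _ => Complex.normSq_nonneg _] at h1
  exact Complex.normSq_eq_zero.1 (h1 i (Finset.mem_univ _))

/-- The inner product `k` as a bilinear form. -/
def kBilin (n : ℕ) : LinearMap.BilinForm ℝ (Mat n) :=
  LinearMap.mk₂ ℝ kForm
    (fun X X' Y => by simp [kForm, Matrix.add_mul])
    (fun c X Y => by simp [kForm])
    (fun X Y Y' => by simp [kForm, Matrix.mul_add])
    (fun c X Y => by simp [kForm])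

lemma kBilin_apply (X Y : Mat n) : kBilin n X Y = kForm X Y := rfl

lemma kForm_add_right (X Y Y' : Mat n) : kForm X (Y + Y') = kForm X Y + kForm X Y' :=
  map_add (kBilin n X) Y Y'

lemma kForm_smul_right (X : Mat n) (c : ℝ) (Y : Mat n) : kForm X (c • Y) = c * kForm X Y :=
  map_smul (kBilin n X) c Y

lemma kForm_sub_right (X Y Y' : Mat n) : kForm X (Y - Y') = kForm X Y - kForm X Y' :=
  map_sub (kBilin n X) Y Y'

lemma exists_orthogonal_projection (W : Submodule ℝ (Mat n)) (X : Mat n) :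
    ∃ Y ∈ W, ∀ V ∈ W, kForm (X - Y) V = 0 := by
  have hrefl : (kBilin n).IsRefl := fun X Y h => by
    rw [kBilin_apply] at h ⊢
    rw [kForm_comm, h]
  have hnd : ((kBilin n).restrict W).Nondegenerate := by
    refine ⟨fun Y hY => ?_, fun Y hY => ?_⟩ <;> exact Subtype.ext (kForm_self_eq_zero (hY Y))
  have hc := LinearMap.BilinForm.isCompl_orthogonal_of_restrict_nondegenerate hrefl hnd
  have hX : X ∈ W ⊔ (kBilin n).orthogonal W := by rw [hc.sup_eq_top]; trivial
  obtain ⟨Y, hY, Z, hZ, rfl⟩ := Submodule.mem_sup.1 hX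
  refine ⟨Y, hY, fun V hV => ?_⟩
  rw [add_sub_cancel_left, kForm_comm]
  exact hZ V hV

lemma kForm_conj {u : SLn n} (hu : u ∈ SUU n) (X Y : Mat n) :
    kForm (mat u * X * mat u⁻¹) (mat u * Y * mat u⁻¹) = kForm X Y := by
  rw [kForm, mat_inv_SUU hu]
  congr 1
  have h : (mat u * X * (mat u)ᴴ)ᴴ * (mat u * Y * (mat u)ᴴ) =
      mat u * (Xᴴ * ((mat u)ᴴ * mat u) * Y * (mat u)ᴴ) := by
    simp only [conjTranspose_mul, conjTranspose_conjTranspose]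
    noncomm_ring
  rw [h, trace_mul_comm, conjTranspose_mul_SUU hu, Matrix.mul_one, Matrix.mul_assoc,
    conjTranspose_mul_SUU hu, Matrix.mul_one]

lemma kForm_suu_left {Z : Mat n} (hZ : Z ∈ suu n) (Y : Mat n) : kForm Z Y = -(Z * Y).trace.re := by
  rw [kForm, conjTranspose_suu hZ, Matrix.neg_mul, trace_neg, Complex.neg_re]

lemma conj_mem_suu {u : SLn n} (hu : u ∈ SUU n) {X : Mat n} (hX : X ∈ suu n) :
    mat u * X * mat u⁻¹ ∈ suu n := by
  rw [mat_inv_SUU hu]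
  obtain ⟨B, hB, z, hz, h⟩ := hu
  obtain ⟨C, w, hC, hw, ht, rfl⟩ := hX
  refine ⟨B * C * Bᴴ, w, ?_, hw, ?_, ?_⟩
  · rw [conjTranspose_mul, conjTranspose_mul, conjTranspose_conjTranspose, hC]
    noncomm_ring
  · have : Bᴴ * B = 1 := mem_unitaryGroup_iff'.1 hB
    rw [← ht, trace_mul_comm, ← Matrix.mul_assoc, this, Matrix.one_mul]
  · have h1 : z * star z = 1 := Unitary.mul_star_self_of_mem hz
    have h2 : z * w * star z = w := by linear_combination w * h1
    rw [h, fromBlocks_conjTranspose, fromBlocks_multiply, fromBlocks_multiply]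
    have h3 : z * w * (starRingEnd ℂ) z = w := h2
    congr 1 <;> simp [smul_smul]
    linear_combination h3

/-! ### Differentiating the adjoint action -/

lemma lie_mem_of_conj_mem {F : Subgroup (SLn n)} (hF : IsAdmissible F) (V : Submodule ℝ (Mat n))
    {X : Mat n} (h : ∀ g ∈ H F, mat g * X * mat g⁻¹ ∈ V) {U : Mat n} (hU : U ∈ lieAlg (H F)) :
    U * X - X * U ∈ V := by
  have htr : ∀ t : ℝ, (t • U).trace = 0 := fun t => by
    rw [trace_smul, trace_eq_zero_of_mem_lieAlg hU, smul_zero]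
  have h1 : ∀ t : ℝ, exp (t • U) * X * exp (t • -U) ∈ V := by
    intro t
    have h2 := h (expSL (t • U) (htr t)) (exp_mem_H hF (Submodule.smul_mem _ _ hU) rfl)
    have h3 : mat (expSL (t • U) (htr t))⁻¹ = exp (t • -U) := by
      rw [smul_neg, Matrix.exp_neg]
      exact (inv_eq_left_inv (mat_inv_mul_mat _)).symm
    rwa [h3] at h2
  have h4 : HasDerivAt (fun t : ℝ => exp (t • U) * X * exp (t • -U)) (U * X - X * U) 0 := by
    have := ((hasDerivAt_exp_smul_const (𝕂 := ℝ) U 0).mul_const X).mul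
      (hasDerivAt_exp_smul_const (𝕂 := ℝ) (-U) 0)
    simp only [zero_smul, NormedSpace.exp_zero, one_mul, mul_one, mul_neg, ← sub_eq_add_neg] at this
    exact this
  have hcl : IsClosed (V : Set (Mat n)) := Submodule.closed_of_finiteDimensional V
  refine hcl.mem_of_tendsto (hasDerivAt_iff_tendsto_slope_zero.1 h4)
    (Eventually.of_forall fun t => ?_)
  exact Submodule.smul_mem _ _ (sub_mem (h1 _) (h1 _))

/-! ### The generator of `𝔞_r` -/

section F

variable {F : Subgroup (SLn n)} (hF : IsAdmissible F)
include hF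

lemma eq_zero_of_mem_aR {X : Mat n} (hX : X ∈ aR F) (ha : aCoord n X = 0) : X = 0 :=
  kForm_self_eq_zero (hX.2 X ((mem_lieAlg_H_iff hF).2 ⟨hX.1, ha⟩))

omit hF in
lemma aCoord_generator {A : Mat n} (hA : IsGenerator F A) : aCoord n A = 1 := by
  have := (mem_suu_iff.1 hA.2).2.2.2
  rw [map_sub, aCoord_A0] at this
  linarith

lemma existsUnique_generator : ∃! A : Mat n, IsGenerator F A := by
  obtain ⟨X, hX, ha⟩ := exists_mem_lieAlg_aCoord_ne_zero hF
  obtain ⟨Y, hY, hXY⟩ := exists_orthogonal_projection (lieAlg (H F)) ((aCoord n X)⁻¹ • X)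
  have hYF := (mem_lieAlg_H_iff hF).1 hY
  have hm : (aCoord n X)⁻¹ • X - Y ∈ lieAlg F := sub_mem (Submodule.smul_mem _ _ hX) hYF.1
  refine ⟨(aCoord n X)⁻¹ • X - Y, ⟨⟨hm, hXY⟩, sub_A0_mem_suu hF hm ?_⟩, fun A' hA' => ?_⟩
  · rw [map_sub, map_smul, hYF.2, smul_eq_mul, inv_mul_cancel₀ ha, sub_zero]
  · refine sub_eq_zero.1 (eq_zero_of_mem_aR hF (sub_mem hA'.1 ⟨hm, hXY⟩) ?_)
    rw [map_sub, map_sub, map_smul, hYF.2, aCoord_generator hA', smul_eq_mul,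
      inv_mul_cancel₀ ha]
    ring

variable {A : Mat n} (hA : IsGenerator F A)
include hA

lemma mem_aR_iff {X : Mat n} : X ∈ aR F ↔ ∃ a : ℝ, X = a • A := by
  constructor
  · intro hX
    refine ⟨aCoord n X, sub_eq_zero.1 (eq_zero_of_mem_aR hF
      (sub_mem hX (Submodule.smul_mem _ _ hA.1)) ?_)⟩
    rw [map_sub, map_smul, aCoord_generator hA, smul_eq_mul, mul_one, sub_self]
  · rintro ⟨a, rfl⟩
    exact Submodule.smul_mem _ _ hA.1

lemma mem_sR_iff {X : Mat n} : X ∈ sR F ↔ ∃ a : ℝ, ∃ W ∈ nil n, X = a • A + W := by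
  rw [sR, Submodule.mem_sup]
  constructor
  · rintro ⟨_, hY, W, hW, rfl⟩
    obtain ⟨a, rfl⟩ := (mem_aR_iff hF hA).1 hY
    exact ⟨a, W, hW, rfl⟩
  · rintro ⟨a, W, hW, rfl⟩
    exact ⟨a • A, Submodule.smul_mem _ _ hA.1, W, hW, rfl⟩

lemma sub_smul_generator_mem {X : Mat n} (hX : X ∈ lieAlg F) :
    X - aCoord n X • A ∈ lieAlg (H F) := by
  refine (mem_lieAlg_H_iff hF).2 ⟨sub_mem hX (Submodule.smul_mem _ _ hA.1.1), ?_⟩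
  rw [map_sub, map_smul, aCoord_generator hA, smul_eq_mul, mul_one, sub_self]

/-- By the uniqueness of the generator, `H` centralizes it. -/
lemma commute_generator {g : SLn n} (hg : g ∈ H F) : Commute (mat g) A := by
  have hconj : IsGenerator F (mat g * A * mat g⁻¹) := by
    refine ⟨⟨conj_mem_lieAlg_self hg.1 hA.1.1, fun Y hY => ?_⟩, ?_⟩
    · have h1 := conj_mem_lieAlg_self (inv_mem hg) hY
      rw [inv_inv] at h1
      have h2 := kForm_conj hg.2 A (mat g⁻¹ * Y * mat g)
      rw [hA.1.2 _ h1] at h2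
      rw [← h2]
      congr 1
      calc Y = (mat g * mat g⁻¹) * Y * (mat g * mat g⁻¹) := by simp
        _ = _ := by noncomm_ring
    · have h1 := conj_mem_suu hg.2 hA.2
      have h2 : mat g * A0 n = A0 n * mat g := (commute_A0_iff.2 (dg_SUU hg.2)).eq
      rw [Matrix.mul_sub, Matrix.sub_mul, h2, Matrix.mul_assoc (A0 n), mat_mul_mat_inv,
        Matrix.mul_one] at h1
      exact h1
  have h := (existsUnique_generator hF).unique hconj hA
  rw [commute_iff_eq]
  calc mat g * A = mat g * A * (mat g⁻¹ * mat g) := by simp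
    _ = mat g * A * mat g⁻¹ * mat g := by noncomm_ring
    _ = A * mat g := by rw [h]

lemma commute_generator_lieAlg {U : Mat n} (hU : U ∈ lieAlg (H F)) : Commute U A := by
  have htr : ∀ t : ℝ, (t • U).trace = 0 := fun t => by
    rw [trace_smul, trace_eq_zero_of_mem_lieAlg hU, smul_zero]
  have h2 : ∀ t : ℝ, exp (t • U) * A = A * exp (t • U) := fun t =>
    (commute_generator hF hA (g := expSL (t • U) (htr t))
      (exp_mem_H hF (Submodule.smul_mem _ _ hU) rfl)).eq
  have h3 := ((hasDerivAt_exp_smul_const (𝕂 := ℝ) U 0).mul_const A)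
  have h4 := ((hasDerivAt_exp_smul_const (𝕂 := ℝ) U 0).const_mul A)
  have h5 := (h3.congr_of_eventuallyEq (Eventually.of_forall fun t => (h2 t).symm)).unique h4
  rw [commute_iff_eq]
  simpa using h5

lemma lieAlg_G_eq_sup : lieAlg (G F) = lieAlg (H F) ⊔ sR F := by
  rw [lieAlg_G hF]
  refine le_antisymm (sup_le (fun X hX => ?_) ?_) (sup_le ?_ (sup_le ?_ le_sup_right))
  · rw [← sub_add_cancel X (aCoord n X • A)]
    exact Submodule.add_mem_sup (sub_smul_generator_mem hF hA hX)
      ((mem_sR_iff hF hA).2 ⟨_, 0, zero_mem _, (add_zero _).symm⟩)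
  · exact le_sup_right.trans le_sup_right
  · exact (lieAlg_mono inf_le_left).trans le_sup_left
  · exact (show aR F ≤ lieAlg F from fun X hX => hX.1).trans le_sup_left

/-! ### The equivariant map of a reductive decomposition -/

variable {m : Submodule ℝ (Mat n)} (hm : IsReductive F m)
include hm

omit hF hA in
lemma eq_of_add_mem {X U U' : Mat n} (hU : U ∈ lieAlg (H F)) (hU' : U' ∈ lieAlg (H F))
    (h : X + U ∈ m) (h' : X + U' ∈ m) : U = U' := by
  have h1 : U - U' ∈ lieAlg (H F) ⊓ m := by
    refine ⟨sub_mem hU hU', ?_⟩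
    have := sub_mem h h'
    rwa [add_sub_add_left_eq_sub] at this
  rw [hm.inf_eq, Submodule.mem_bot] at h1
  exact sub_eq_zero.1 h1

lemma existsUnique_graphMap : ∃! φ : sR F →ₗ[ℝ] lieAlg (H F), IsGraphMap F m φ := by
  have hex : ∀ X : sR F, ∃ U : lieAlg (H F), (X : Mat n) + U ∈ m := by
    intro X
    have hX : (X : Mat n) ∈ lieAlg (H F) ⊔ m := by
      rw [hm.sup_eq, lieAlg_G_eq_sup hF hA]
      exact Submodule.mem_sup_right X.2
    obtain ⟨U, hU, M, hM, h⟩ := Submodule.mem_sup.1 hX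
    refine ⟨⟨-U, neg_mem hU⟩, ?_⟩
    rwa [← h, add_neg_cancel_comm]
  choose f hf using hex
  have huniq : ∀ (X : sR F) (U : lieAlg (H F)), (X : Mat n) + U ∈ m → U = f X := fun X U h =>
    Subtype.ext (eq_of_add_mem hm U.2 (f X).2 h (hf X))
  let φ : sR F →ₗ[ℝ] lieAlg (H F) :=
    { toFun := f
      map_add' := fun X Y => (huniq _ _ (by
        have := add_mem (hf X) (hf Y)
        rwa [add_add_add_comm] at this)).symm
      map_smul' := fun c X => (huniq _ _ (by
        have := Submodule.smul_mem m c (hf X)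
        rwa [smul_add] at this)).symm }
  have hφ : IsGraphMap F m φ := by
    constructor
    · intro U hU X X' hX'
      have h1 := lie_mem_of_conj_mem hF m (fun g hg => hm.ad_mem g hg _ (hf X)) hU
      have h2 := lie_mem_of_conj_mem hF (lieAlg (H F))
        (fun g hg => conj_mem_lieAlg_self hg (f X).2) hU
      refine congrArg Subtype.val (huniq X' ⟨_, h2⟩ ?_).symm
      rw [hX']
      convert h1 using 1
      noncomm_ring
    · intro Y
      refine ⟨fun hY => ?_, ?_⟩
      · have hYG : Y ∈ lieAlg (H F) ⊔ sR F := by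
          rw [← lieAlg_G_eq_sup hF hA, ← hm.sup_eq]
          exact Submodule.mem_sup_right hY
        obtain ⟨U, hU, X, hX, rfl⟩ := Submodule.mem_sup.1 hYG
        refine ⟨⟨X, hX⟩, ?_⟩
        have := huniq ⟨X, hX⟩ ⟨U, hU⟩ (by simpa [add_comm] using hY)
        change U + X = X + (f ⟨X, hX⟩ : Mat n)
        rw [← this, add_comm]
      · rintro ⟨X, rfl⟩
        exact hf X
  refine ⟨φ, hφ, fun ψ hψ => LinearMap.ext fun X => ?_⟩
  exact huniq X (ψ X) ((hψ.graph _).2 ⟨X, rfl⟩)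

variable {φ : sR F →ₗ[ℝ] lieAlg (H F)} (hφ : IsGraphMap F m φ)
include hφ

omit hF hA in
/-- The map `φ_r` is equivariant for the whole group `H`. -/
lemma graphMap_conj {g : SLn n} (hg : g ∈ H F) {X Y : sR F}
    (hY : (Y : Mat n) = mat g * X * mat g⁻¹) : (φ Y : Mat n) = mat g * φ X * mat g⁻¹ := by
  refine eq_of_add_mem hm (X := (Y : Mat n)) (φ Y).2 (conj_mem_lieAlg_self hg (φ X).2)
    ((hφ.graph _).2 ⟨Y, rfl⟩) ?_
  have := hm.ad_mem g hg _ ((hφ.graph _).2 ⟨X, rfl⟩)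
  rw [hY]
  convert this using 1
  noncomm_ring

end F

/-! ### The image of `𝔫` lies in the holonomy algebra -/

/-- The holonomy bundle through `1 ∈ G`: the elements of `G` that can be joined to `1` by a
horizontal curve. As the connection is `G`-invariant, it is a subgroup. -/
def holonomyBundle (F : Subgroup (SLn n)) (m : Submodule ℝ (Mat n)) : Subgroup (SLn n) where
  carrier := {g | g ∈ G F ∧ HorizontallyJoined F m 1 g}
  one_mem' := ⟨one_mem _, Relation.ReflTransGen.refl⟩
  mul_mem' := by
    rintro a b ⟨ha, ha'⟩ ⟨hb, hb'⟩
    refine ⟨mul_mem ha hb, ha'.trans ?_⟩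
    have h := hb'.mul_left F m ha
    rwa [mul_one] at h
  inv_mem' := by
    rintro a ⟨ha, ha'⟩
    refine ⟨inv_mem ha, ?_⟩
    have h := ha'.mul_left F m (inv_mem ha)
    simpa using h.symm F m

lemma mem_holonomyGroup_iff {F : Subgroup (SLn n)} {m : Submodule ℝ (Mat n)} {g : SLn n} :
    g ∈ holonomyGroup F m ↔ g ∈ H F ∧ g ∈ holonomyBundle F m :=
  ⟨fun h => ⟨h.1, H_le_G F h.1, h.2⟩, fun h => ⟨h.1, h.2.2⟩⟩

/-- A horizontal curve from `1`, given by its logarithmic derivative `u`, stays in the holonomy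
bundle. -/
lemma mem_holonomyBundle_of_curve {F : Subgroup (SLn n)} {m : Submodule ℝ (Mat n)}
    {γ : ℝ → SLn n} {u : ℝ → Mat n} (h0 : γ 0 = 1) (hu : Continuous u) (hG : ∀ t, γ t ∈ G F)
    (hm : ∀ t, u t ∈ m) (hd : ∀ t, HasDerivAt (fun s => mat (γ s)) (mat (γ t) * u t) t) :
    γ 1 ∈ holonomyBundle F m :=
  ⟨hG 1, Relation.ReflTransGen.single ⟨γ, u, h0, rfl, fun i j => (hu.matrix_elem i j).continuousOn,
    fun t _ => ⟨hG t, hm t, fun i j => (hasDerivAt_matrix.1 (hd t) i j).hasDerivWithinAt⟩⟩⟩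

lemma mat_inv_of_exp {g : SLn n} {X : Mat n} (h : mat g = exp X) : mat g⁻¹ = exp (-X) := by
  rw [Matrix.exp_neg, ← h]
  exact (inv_eq_left_inv (mat_inv_mul_mat g)).symm

/-- Conjugation by `exp A₀` is expanding on `𝔫`. -/
lemma eq_zero_of_kForm_conj_exp_A0 {X : Mat n} (hX : X ∈ nil n)
    (h : kForm (exp (A0 n) * X * exp (-A0 n)) (exp (A0 n) * X * exp (-A0 n)) = kForm X X) :
    X = 0 := by
  obtain ⟨ht, hd, -⟩ := mem_nil_iff.1 hX
  have hz : ∀ i j, lvl n i = lvl n j → X i j = 0 := fun i j h => by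
    have := congrFun (congrFun hd i) j
    rwa [dg_apply, if_pos h] at this
  have h1 := exp_smul_A0 (n := n) 1
  have h2 := exp_smul_A0 (n := n) (-1)
  rw [one_smul] at h1
  rw [neg_smul, one_smul, neg_neg] at h2
  have hn : ∀ z : ℂ, (star z * z).re = Complex.normSq z := fun z => by
    simp [Complex.normSq_apply]
  rw [h1, h2, kForm_eq_sum, kForm_eq_sum, ← sub_eq_zero, ← Finset.sum_sub_distrib] at h
  simp only [← Finset.sum_sub_distrib, hn, mul_diagonal, diagonal_mul, map_mul] at h
  have he : Complex.normSq (Complex.exp 1) = Real.exp 1 * Real.exp 1 := by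
    rw [← Complex.ofReal_one, ← Complex.ofReal_exp, Complex.normSq_ofReal]
  have he1 : 1 < Real.exp 1 := Real.one_lt_exp_iff.2 one_pos
  -- The factor by which the square of an entry above the block diagonal is enlarged.
  have key : ∀ i j, ∃ c : ℝ, 0 < c ∧
      Complex.normSq ((Sum.elim 1 ![(Real.exp 1 : ℂ), (Real.exp (-1) : ℂ)] :
          Fin (n - 1) ⊕ Fin 2 → ℂ) i) * Complex.normSq (X i j) *
        Complex.normSq ((Sum.elim 1 ![(Real.exp (-1) : ℂ), (Real.exp 1 : ℂ)] :
          Fin (n - 1) ⊕ Fin 2 → ℂ) j) - Complex.normSq (X i j) = c * Complex.normSq (X i j) := by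
    intro i j
    by_cases hij : lvl n i < lvl n j
    · rcases i with i | i <;> rcases j with j | j
      · simp at hij
      · fin_cases j
        · simp at hij
        · refine ⟨Real.exp 1 * Real.exp 1 - 1, by nlinarith, ?_⟩
          simp [he]
          ring
      · fin_cases i
        · refine ⟨Real.exp 1 * Real.exp 1 - 1, by nlinarith, ?_⟩
          simp [he]
          ring
        · simp at hij
      · fin_cases i <;> fin_cases j
        · simp at hij
        · refine ⟨(Real.exp 1 * Real.exp 1) * (Real.exp 1 * Real.exp 1) - 1, by
            have : 1 < Real.exp 1 * Real.exp 1 := by nlinarith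
            nlinarith, ?_⟩
          simp [he]
          ring
        · simp at hij
        · simp at hij
    · refine ⟨1, one_pos, ?_⟩
      have : X i j = 0 := by
        rcases (not_lt.1 hij).lt_or_eq with h | h
        · exact ht h
        · exact hz _ _ h.symm
      simp [this]
  choose c hc hcX using key
  have h' : ∑ i, ∑ j, c j i * Complex.normSq (X j i) = 0 := by
    rw [← h]
    refine Finset.sum_congr rfl fun i _ => Finset.sum_congr rfl fun j _ => ?_
    rw [← hcX j i]
  have hnn : ∀ i j, 0 ≤ c j i * Complex.normSq (X j i) := fun i j =>
    mul_nonneg (hc _ _).le (Complex.normSq_nonneg _)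
  rw [Finset.sum_eq_zero_iff_of_nonneg fun i _ => Finset.sum_nonneg fun j _ => hnn i j] at h'
  ext i j
  have h3 := h' j (Finset.mem_univ _)
  rw [Finset.sum_eq_zero_iff_of_nonneg fun i _ => hnn j i] at h3
  have h4 := h3 i (Finset.mem_univ _)
  exact Complex.normSq_eq_zero.1 ((mul_eq_zero.1 h4).resolve_left (hc i j).ne')

section F

variable {F : Subgroup (SLn n)} {m : Submodule ℝ (Mat n)} {φ : sR F →ₗ[ℝ] lieAlg (H F)}

/-- The restriction of `φ_r` to `𝔫`. -/
def nilMap (φ : sR F →ₗ[ℝ] lieAlg (H F)) : nil n →ₗ[ℝ] lieAlg (H F) :=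
  φ ∘ₗ Submodule.inclusion le_sup_right

variable (hF : IsAdmissible F) (hm : IsReductive F m) (hφ : IsGraphMap F m φ)
include hφ

lemma add_nilMap_mem (X : nil n) : (X + nilMap φ X : Mat n) ∈ m :=
  (hφ.graph _).2 ⟨Submodule.inclusion le_sup_right X, rfl⟩

include hF hm

omit hF in
lemma nilMap_conj {g : SLn n} (hg : g ∈ H F) {X Y : nil n}
    (hY : (Y : Mat n) = mat g * X * mat g⁻¹) :
    (nilMap φ Y : Mat n) = mat g * nilMap φ X * mat g⁻¹ :=
  graphMap_conj hm hφ hg hY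

/-- The horizontal lift of the curve `exp (t X)`, `X ∈ 𝔫`, is `exp (t X) exp (t φ_r X)`. -/
lemma exp_mul_exp_mem_holonomyBundle (X : nil n) {a b : SLn n} (ha : mat a = exp (X : Mat n))
    (hb : mat b = exp (nilMap φ X : Mat n)) : a * b ∈ holonomyBundle F m := by
  set U : Mat n := ((nilMap φ X : lieAlg (H F)) : Mat n) with hU
  have hUH : U ∈ lieAlg (H F) := (nilMap φ X).2
  set x : ℝ → SLn n := fun t => expSL (t • (X : Mat n)) (by rw [trace_smul, trace_nil X.2, smul_zero])
  set y : ℝ → SLn n := fun t => expSL (t • U)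
    (by rw [trace_smul, trace_eq_zero_of_mem_lieAlg hUH, smul_zero])
  have hyH : ∀ t, y t ∈ H F := fun t => exp_mem_H hF (Submodule.smul_mem _ t hUH) rfl
  have hyinv : ∀ t, mat (y t)⁻¹ = exp (t • -U) := fun t => by
    rw [smul_neg]; exact mat_inv_of_exp rfl
  have hcomm : ∀ t : ℝ, Commute (exp (t • U)) U := fun t => ((Commute.refl U).smul_left t).exp_left
  have hab : a * b = x 1 * y 1 :=
    mat_injective (by rw [map_mul, map_mul, ha, hb, mat_expSL, mat_expSL, one_smul, one_smul])
  rw [hab]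
  refine mem_holonomyBundle_of_curve (γ := fun t => x t * y t)
    (u := fun t => mat (y t)⁻¹ * X * mat (y t) + U) (mat_injective ?_) ?_ ?_ ?_ ?_
  · simp [x, y]
  · simp only [hyinv]
    exact (((continuous_exp_smul (-U)).mul continuous_const).mul (continuous_exp_smul U)).add
      continuous_const
  · exact fun t => mul_mem
      (Nil_le_G F (exp_mem_Nil (Submodule.smul_mem _ t X.2) rfl)) (H_le_G F (hyH t))
  · intro t
    have h1 : mat (y t)⁻¹ * X * mat (y t) ∈ nil n := by
      have := conj_mem_nil hF (inv_mem (hyH t).1) X.2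
      rwa [inv_inv] at this
    have h2 := nilMap_conj hm hφ (inv_mem (hyH t)) (X := X) (Y := ⟨_, h1⟩) (by rw [inv_inv])
    have h3 : (nilMap φ ⟨_, h1⟩ : Mat n) = U := by
      have h4 : mat (y t) * U = U * mat (y t) := (hcomm t).eq
      rw [h2, inv_inv, ← hU, Matrix.mul_assoc, ← h4, ← Matrix.mul_assoc, mat_inv_mul_mat,
        Matrix.one_mul]
    have h4 := add_nilMap_mem hφ ⟨_, h1⟩
    rwa [h3] at h4
  · intro t
    have h1 := (hasDerivAt_exp_smul_const (𝕂 := ℝ) (X : Mat n) t).mul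
      (hasDerivAt_exp_smul_const (𝕂 := ℝ) U t)
    have h2 : mat (x t) * mat (y t) * (mat (y t)⁻¹ * X * mat (y t) + U) =
        mat (x t) * (mat (y t) * mat (y t)⁻¹) * X * mat (y t) + mat (x t) * (mat (y t) * U) := by
      noncomm_ring
    rw [mat_mul_mat_inv, Matrix.mul_one] at h2
    simp only [map_mul, h2]
    exact h1

variable {A : Mat n} (hA : IsGenerator F A)
include hA

omit hm in
/-- `A_r + φ_r A_r` centralizes `𝔥`. -/
lemma commute_generator_add {U : Mat n} (hU : U ∈ lieAlg (H F)) :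
    Commute (A + φ ⟨A, Submodule.mem_sup_left hA.1⟩) U := by
  refine Commute.add_left (commute_generator_lieAlg hF hA hU).symm ?_
  have h := hφ.equivariant U hU ⟨A, Submodule.mem_sup_left hA.1⟩ 0 (by
    rw [(commute_generator_lieAlg hF hA hU).eq]
    simp)
  rw [map_zero, Submodule.coe_zero, eq_comm, sub_eq_zero] at h
  exact h.symm

omit hF hφ hm in
lemma generator_add_mem_lieAlg {U : Mat n} (hU : U ∈ lieAlg (H F)) : A + U ∈ lieAlg F :=
  add_mem hA.1.1 (lieAlg_mono inf_le_left hU)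

omit hm in
lemma exp_generator_mem_holonomyBundle {a : SLn n}
    (ha : mat a = exp (A + φ ⟨A, Submodule.mem_sup_left hA.1⟩)) : a ∈ holonomyBundle F m := by
  set M : Mat n := A + φ ⟨A, Submodule.mem_sup_left hA.1⟩
  have hMF : M ∈ lieAlg F := generator_add_mem_lieAlg hA (φ _).2
  have hMm : M ∈ m := (hφ.graph _).2 ⟨⟨A, Submodule.mem_sup_left hA.1⟩, rfl⟩
  have htr : ∀ t : ℝ, (t • M).trace = 0 := fun t => by
    rw [trace_smul, trace_eq_zero_of_mem_lieAlg hMF, smul_zero]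
  have ha1 : a = expSL ((1 : ℝ) • M) (htr 1) := mat_injective (by rw [ha, mat_expSL, one_smul])
  rw [ha1]
  refine mem_holonomyBundle_of_curve (γ := fun t => expSL (t • M) (htr t)) (u := fun _ => M)
    (mat_injective (by simp)) continuous_const (fun t => F_le_G F ?_) (fun _ => hMm)
    (fun t => hasDerivAt_exp_smul_const (𝕂 := ℝ) M t)
  exact exp_mem_of_mem_lieAlg hF.isClosed (Submodule.smul_mem _ t hMF) rfl

/-- Transporting a horizontal lift along `exp (A_r + φ_r A_r)` and closing it up. -/
lemma nilMap_sub_mem_holonomyAlgebra {a : SLn n}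
    (ha : mat a = exp (A + φ ⟨A, Submodule.mem_sup_left hA.1⟩)) {X Y : nil n}
    (hY : (Y : Mat n) = mat a * X * mat a⁻¹) :
    (nilMap φ X - nilMap φ Y : Mat n) ∈ holonomyAlgebra F m := by
  have hX1 : (nilMap φ X : Mat n) ∈ lieAlg (H F) := (nilMap φ X).2
  have hY1 : (-nilMap φ Y : Mat n) ∈ lieAlg (H F) := neg_mem (nilMap φ Y).2
  have htr : ∀ {V : Mat n}, V ∈ lieAlg (H F) → ∀ t : ℝ, (t • V).trace = 0 := fun hV t => by
    rw [trace_smul, trace_eq_zero_of_mem_lieAlg hV, smul_zero]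
  have htn : ∀ (W : nil n) (t : ℝ), (t • (W : Mat n)).trace = 0 := fun W t => by
    rw [trace_smul, trace_nil W.2, smul_zero]
  rw [sub_eq_neg_add]
  refine mem_lieAlg_iff.2 ⟨_, fun t => mem_holonomyGroup_iff.2 ⟨?_, ?_⟩,
    (IsCurve.exp (γ := fun t => expSL (t • (-nilMap φ Y : Mat n)) (htr hY1 t)) fun t => rfl).mul
    (IsCurve.exp (γ := fun t => expSL (t • (nilMap φ X : Mat n)) (htr hX1 t)) fun t => rfl)⟩
  · exact mul_mem (exp_mem_H hF (Submodule.smul_mem _ t hY1) rfl)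
      (exp_mem_H hF (Submodule.smul_mem _ t hX1) rfl)
  · have haP := exp_generator_mem_holonomyBundle hF hφ hA ha
    have h1 := exp_mul_exp_mem_holonomyBundle hF hm hφ (t • X)
      (a := expSL (t • (X : Mat n)) (htn X t)) (b := expSL (t • (nilMap φ X : Mat n)) (htr hX1 t))
      rfl (by rw [map_smul]; rfl)
    have h2 := exp_mul_exp_mem_holonomyBundle hF hm hφ (t • Y)
      (a := expSL (t • (Y : Mat n)) (htn Y t))
      (b := expSL (t • (nilMap φ Y : Mat n)) (htr (nilMap φ Y).2 t)) rfl (by rw [map_smul]; rfl)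
    have h3 := mul_mem (inv_mem h2) (mul_mem (mul_mem haP h1) (inv_mem haP))
    convert h3 using 1
    apply mat_injective
    have hc : Commute (mat a) (exp (t • (nilMap φ X : Mat n))) := by
      rw [ha]
      exact ((commute_generator_add hF hφ hA hX1).smul_right t).exp
    have hconj : mat a * exp (t • (X : Mat n)) = exp (t • (Y : Mat n)) * mat a := by
      have : SemiconjBy (mat a) (t • (X : Mat n)) (t • (Y : Mat n)) := by
        rw [SemiconjBy, hY, mul_smul_comm, smul_mul_assoc, Matrix.mul_assoc _ (mat a⁻¹),
          mat_inv_mul_mat, Matrix.mul_one]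
      exact this.exp_right
    have hYinv : mat (expSL (t • (nilMap φ Y : Mat n)) (htr (nilMap φ Y).2 t))⁻¹ =
        exp (t • (-nilMap φ Y : Mat n)) := by
      rw [smul_neg]; exact mat_inv_of_exp rfl
    simp only [map_mul, _root_.mul_inv_rev, hYinv, mat_expSL]
    calc _ = exp (t • (-nilMap φ Y : Mat n)) *
          (mat (expSL (t • (Y : Mat n)) (htn Y t))⁻¹ * mat (expSL (t • (Y : Mat n)) (htn Y t))) *
            exp (t • (nilMap φ X : Mat n)) * (mat a * mat a⁻¹) := by
          rw [mat_inv_mul_mat, mat_mul_mat_inv, Matrix.mul_one, Matrix.mul_one]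
      _ = exp (t • (-nilMap φ Y : Mat n)) * mat (expSL (t • (Y : Mat n)) (htn Y t))⁻¹ *
          (exp (t • (Y : Mat n)) * (exp (t • (nilMap φ X : Mat n)) * mat a)) * mat a⁻¹ := by
          rw [mat_expSL]; noncomm_ring
      _ = _ := by
          rw [← hc.eq, ← Matrix.mul_assoc (exp (t • (Y : Mat n))), ← hconj]
          noncomm_ring

lemma nilMap_mem_holonomyAlgebra (X : nil n) : (nilMap φ X : Mat n) ∈ holonomyAlgebra F m := by
  set U : Mat n := ((φ ⟨A, Submodule.mem_sup_left hA.1⟩ : lieAlg (H F)) : Mat n) with hU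
  have hUH : U ∈ lieAlg (H F) := (φ _).2
  have hMF : A + U ∈ lieAlg F := generator_add_mem_lieAlg hA hUH
  set a : SLn n := expSL (A + U) (trace_eq_zero_of_mem_lieAlg hMF)
  have haF : a ∈ F := exp_mem_of_mem_lieAlg hF.isClosed hMF rfl
  have hS : A - A0 n + U ∈ suu n := add_mem hA.2 (lieAlg_H_le_suu hF hUH)
  set u : SLn n := expSL (A - A0 n + U) (mem_suu_iff.1 hS).2.2.1
  have huS : u ∈ SUU n := exp_mem_SUU hS rfl
  have hau : mat a = mat u * exp (A0 n) := by
    change exp (A + U) = exp (A - A0 n + U) * exp (A0 n)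
    rw [← Matrix.exp_add_of_commute _ _ (commute_A0_suu hS)]
    congr 1
    abel
  have hEE : exp (A0 n) * exp (-A0 n) = 1 := by
    rw [← Matrix.exp_add_of_commute _ _ (Commute.refl (A0 n)).neg_right, add_neg_cancel,
      NormedSpace.exp_zero]
  have hau' : mat a⁻¹ = exp (-A0 n) * mat u⁻¹ := by
    have h : mat a * (exp (-A0 n) * mat u⁻¹) = 1 := by
      calc _ = mat u * (exp (A0 n) * exp (-A0 n)) * mat u⁻¹ := by rw [hau]; noncomm_ring
        _ = 1 := by rw [hEE, Matrix.mul_one, mat_mul_mat_inv]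
    calc mat a⁻¹ = mat a⁻¹ * (mat a * (exp (-A0 n) * mat u⁻¹)) := by rw [h, Matrix.mul_one]
      _ = _ := by rw [← Matrix.mul_assoc, mat_inv_mul_mat, Matrix.one_mul]
  let L : nil n →ₗ[ℝ] nil n :=
    { toFun := fun X => X - ⟨mat a * X * mat a⁻¹, conj_mem_nil hF haF X.2⟩
      map_add' := fun X Y => by
        ext1
        simp only [Submodule.coe_add, Submodule.coe_sub, Matrix.mul_add, Matrix.add_mul]
        abel
      map_smul' := fun c X => by
        ext1
        simp only [Submodule.coe_smul, Submodule.coe_sub, mul_smul_comm, smul_mul_assoc,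
          RingHom.id_apply, smul_sub] }
  have hL : Function.Injective L := by
    rw [← LinearMap.ker_eq_bot, LinearMap.ker_eq_bot']
    intro X hX
    have hX' : (X : Mat n) = mat a * X * mat a⁻¹ := congrArg Subtype.val (sub_eq_zero.1 hX)
    refine Subtype.ext (eq_zero_of_kForm_conj_exp_A0 X.2 ?_)
    rw [← kForm_conj huS]
    have : mat u * (exp (A0 n) * X * exp (-A0 n)) * mat u⁻¹ = X := by
      conv_rhs => rw [hX', hau, hau']
      noncomm_ring
    rw [this]
  obtain ⟨W, hW⟩ := LinearMap.injective_iff_surjective.1 hL X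
  have h := nilMap_sub_mem_holonomyAlgebra hF hm hφ hA (a := a) rfl (X := W)
    (Y := ⟨mat a * W * mat a⁻¹, conj_mem_nil hF haF W.2⟩) rfl
  have h2 : nilMap φ X = nilMap φ W - nilMap φ ⟨mat a * W * mat a⁻¹, conj_mem_nil hF haF W.2⟩ := by
    rw [← map_sub, ← hW]
    rfl
  rw [h2]
  exact h

end F

/-! ### Spectral projections and determinants of their ranges -/

section Spectral

variable {ι : Type*} [Fintype ι]

lemma trace_mul_lie (S T Z : Matrix ι ι ℂ) :
    (T * (Z * S - S * Z)).trace = (Z * (S * T - T * S)).trace := by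
  rw [Matrix.mul_sub, Matrix.mul_sub, trace_sub, trace_sub, trace_mul_comm T,
    ← Matrix.mul_assoc T, trace_mul_comm (T * S), Matrix.mul_assoc]

lemma hasDerivAt_linearMap {E : Type*} [NormedAddCommGroup E] [NormedSpace ℝ E]
    (l : Matrix ι ι ℂ →ₗ[ℝ] E) {f : ℝ → Matrix ι ι ℂ} {f' : Matrix ι ι ℂ} {t : ℝ}
    (h : HasDerivAt f f' t) : HasDerivAt (fun t => l (f t)) (l f') t :=
  (LinearMap.toContinuousLinearMap l).hasFDerivAt.comp_hasDerivAt t h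

variable [DecidableEq ι]

/-- The spectral decomposition of a skew-Hermitian matrix. -/
lemma exists_spectral_projections {Z : Matrix ι ι ℂ} (hZ : Zᴴ = -Z) :
    ∃ (s : Finset ℝ) (P : ℝ → Matrix ι ι ℂ), (∀ l, P l * P l = P l) ∧
      (∀ M, Commute M Z → ∀ l, Commute M (P l)) ∧
      Z = ∑ l ∈ s, ((l : ℂ) * Complex.I) • P l := by
  set A : Matrix ι ι ℂ := (-Complex.I) • Z with hAdef
  have hA : A.IsHermitian := by
    rw [IsHermitian, hAdef, conjTranspose_smul, hZ]
    simp
  have hZA : Z = Complex.I • A := by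
    rw [hAdef, smul_smul]
    simp
  set U : Matrix ι ι ℂ := (hA.eigenvectorUnitary : Matrix ι ι ℂ) with hU
  have hU1 : star U * U = 1 := Unitary.star_mul_self_of_mem hA.eigenvectorUnitary.2
  have hU2 : U * star U = 1 := Unitary.mul_star_self_of_mem hA.eigenvectorUnitary.2
  set d : ι → ℝ := hA.eigenvalues
  have hsp : A = U * diagonal (fun i => (d i : ℂ)) * star U := by
    conv_lhs => rw [hA.spectral_theorem, Unitary.conjStarAlgAut_apply]
    rfl
  refine ⟨Finset.univ.image d, fun l => U * diagonal (fun i => if d i = l then 1 else 0) * star U,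
    fun l => ?_, fun M hM l => ?_, ?_⟩
  · calc _ = U * (diagonal (fun i => if d i = l then (1 : ℂ) else 0) * (star U * U) *
          diagonal (fun i => if d i = l then (1 : ℂ) else 0)) * star U := by noncomm_ring
      _ = _ := by
        rw [hU1, Matrix.mul_one, diagonal_mul_diagonal]
        congr 3
        ext i
        simp
  · -- In an eigenbasis, a matrix that commutes with `Z` has no entries between distinct eigenvalues.
    have hMA : M * A = A * M := by
      rw [hAdef, mul_smul_comm, hM.eq, smul_mul_assoc]
    set M' : Matrix ι ι ℂ := star U * M * U with hM'
    have hMM' : M = U * M' * star U := by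
      calc M = (U * star U) * M * (U * star U) := by rw [hU2]; simp
        _ = _ := by rw [hM']; noncomm_ring
    have hc : M' * diagonal (fun i => (d i : ℂ)) = diagonal (fun i => (d i : ℂ)) * M' := by
      have h1 : diagonal (fun i => (d i : ℂ)) = star U * A * U := by
        calc diagonal (fun i => (d i : ℂ)) = (star U * U) * diagonal (fun i => (d i : ℂ)) *
              (star U * U) := by rw [hU1]; simp
          _ = _ := by rw [hsp]; noncomm_ring
      calc M' * diagonal (fun i => (d i : ℂ)) = star U * M * (U * star U) * A * U := by
            rw [h1, hM']; noncomm_ring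
        _ = star U * (M * A) * U := by rw [hU2]; noncomm_ring
        _ = star U * A * (U * star U) * M * U := by rw [hMA, hU2]; noncomm_ring
        _ = _ := by rw [h1, hM']; noncomm_ring
    have hentry : ∀ i j, d i = d j ∨ M' i j = 0 := by
      intro i j
      have h1 := congrFun (congrFun hc i) j
      rw [mul_diagonal, diagonal_mul, mul_comm, ← sub_eq_zero, ← sub_mul, mul_eq_zero,
        sub_eq_zero] at h1
      rcases h1 with h1 | h1
      · exact Or.inl (by exact_mod_cast h1.symm)
      · exact Or.inr h1
    have hc' : M' * diagonal (fun i => if d i = l then (1 : ℂ) else 0) =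
        diagonal (fun i => if d i = l then (1 : ℂ) else 0) * M' := by
      ext i j
      rw [mul_diagonal, diagonal_mul]
      rcases hentry i j with h | h
      · rw [h, mul_comm]
      · rw [h]; simp
    rw [commute_iff_eq]
    calc M * (U * diagonal (fun i => if d i = l then (1 : ℂ) else 0) * star U)
        = U * (M' * (star U * U) * diagonal (fun i => if d i = l then (1 : ℂ) else 0)) * star U := by
          conv_lhs => rw [hMM']
          noncomm_ring
      _ = U * (diagonal (fun i => if d i = l then (1 : ℂ) else 0) * (star U * U) * M') * star U := by
          rw [hU1, Matrix.mul_one, Matrix.mul_one, hc']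
      _ = _ := by
          conv_rhs => rw [hMM']
          noncomm_ring
  · rw [hZA, hsp]
    have h1 : ∀ l : ℝ, ((l : ℂ) * Complex.I) •
        (U * diagonal (fun i => if d i = l then (1 : ℂ) else 0) * star U) =
        U * diagonal (fun i => if d i = l then (l : ℂ) * Complex.I else 0) * star U := by
      intro l
      rw [← smul_mul_assoc, ← mul_smul_comm, ← diagonal_smul]
      congr 3
      ext i
      simp
    have h2 : (Complex.I • diagonal fun i => (d i : ℂ)) = ∑ l ∈ Finset.univ.image d,
        diagonal (fun i => if d i = l then (l : ℂ) * Complex.I else 0) := by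
      rw [← diagonal_smul]
      ext i j
      rw [Matrix.sum_apply]
      by_cases hij : i = j
      · subst hij
        simp [mul_comm]
      · simp [hij]
    simp only [h1]
    rw [← Finset.sum_mul, ← Finset.mul_sum, ← h2, mul_smul_comm, smul_mul_assoc]

/-- The determinant of the restriction of `M` to the range of an idempotent `P` that commutes
with `M`. -/
def detOn (P M : Matrix ι ι ℂ) : ℂ := (1 + P * (M - 1)).det

@[simp] lemma detOn_one (P : Matrix ι ι ℂ) : detOn P 1 = 1 := by simp [detOn]

lemma hasDerivWithinAt_detOn {P : Matrix ι ι ℂ} (hP : P * P = P) {κ : ℝ → Matrix ι ι ℂ}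
    {u : Matrix ι ι ℂ} {s : Set ℝ} {t : ℝ} (hc : Commute (κ t) P)
    (h : HasDerivWithinAt κ (κ t * u) s t) :
    HasDerivWithinAt (fun s => detOn P (κ s)) (detOn P (κ t) * (P * u).trace) s t := by
  refine hasDerivWithinAt_det (κ := fun s => 1 + P * (κ s - 1)) (u := P * u) ?_
  have h1 := ((h.sub_const 1).const_mul P).const_add 1
  have h2 : (1 + P * (κ t - 1)) * (P * u) = P * (κ t * u) := by
    calc (1 + P * (κ t - 1)) * (P * u) = P * u + P * (κ t * P) * u - P * P * u := by noncomm_ring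
      _ = P * u + (P * P) * κ t * u - P * P * u := by rw [hc.eq]; noncomm_ring
      _ = P * (κ t * u) := by rw [hP]; noncomm_ring
  rw [h2]
  exact hasDerivWithinAt_matrix.1 h1

/-- `M ↦ tr (P M)`, as a real-linear map. -/
def traceMul (P : Matrix ι ι ℂ) : Matrix ι ι ℂ →ₗ[ℝ] ℂ where
  toFun M := (P * M).trace
  map_add' M N := by rw [Matrix.mul_add, trace_add]
  map_smul' c M := by rw [mul_smul_comm, trace_smul]; rfl

end Spectral

/-! ### The orthogonal complement of the image of `𝔫` -/

section F

variable {F : Subgroup (SLn n)} {m : Submodule ℝ (Mat n)} {φ : sR F →ₗ[ℝ] lieAlg (H F)}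
  (hF : IsAdmissible F) (hφ : IsGraphMap F m φ)
include hF hφ

lemma lie_nilMap {U : Mat n} (hU : U ∈ lieAlg (H F)) (W : nil n) :
    ∃ W' : nil n, (nilMap φ W' : Mat n) = U * nilMap φ W - nilMap φ W * U := by
  have hW : U * W - W * U ∈ nil n :=
    lie_mem_of_conj_mem hF (nil n) (fun g hg => conj_mem_nil hF hg.1 W.2) hU
  exact ⟨⟨_, hW⟩, hφ.equivariant U hU (Submodule.inclusion le_sup_right W)
    (Submodule.inclusion le_sup_right ⟨_, hW⟩) rfl⟩

/-- The image of `𝔫` is an ideal of `𝔥`, so it commutes with its orthogonal complement. -/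
lemma commute_nilMap_of_orthogonal {Z : Mat n} (hZ : Z ∈ lieAlg (H F))
    (horth : ∀ W : nil n, kForm Z (nilMap φ W) = 0) (W : nil n) :
    Commute (nilMap φ W : Mat n) Z := by
  obtain ⟨W', hW'⟩ := lie_nilMap hF hφ hZ W
  obtain ⟨V, hV⟩ := lie_nilMap hF hφ (nilMap φ W).2 W'
  have h1 := horth V
  rw [hV, kForm_suu_left (lieAlg_H_le_suu hF hZ)] at h1
  have h2 : kForm (nilMap φ W' : Mat n) (nilMap φ W') = 0 := by
    rw [kForm_suu_left (lieAlg_H_le_suu hF (nilMap φ W').2), ← h1, ← trace_mul_lie]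
    conv_lhs => rw [hW']
    conv_rhs => rw [hW']
  have h3 := kForm_self_eq_zero h2
  rw [hW', sub_eq_zero] at h3
  exact h3.symm

/-! ### Determinant characters along horizontal curves -/

variable {A : Mat n} (hA : IsGenerator F A)
include hA

/-- The block-diagonal part of an element of `𝔪`. -/
lemma exists_dg_eq_of_mem {u : Mat n} (hu : u ∈ m) : u.BlockTriangular (lvl n) ∧
    ∃ (a : ℝ) (W : nil n), dg u = a • (A + φ ⟨A, Submodule.mem_sup_left hA.1⟩) + nilMap φ W := by
  obtain ⟨X, rfl⟩ := (hφ.graph u).1 hu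
  obtain ⟨a, W, hW, hX⟩ := (mem_sR_iff hF hA).1 X.2
  have hφX : dg (φ X : Mat n) = φ X := dg_lieAlg_F hF (lieAlg_mono inf_le_left (φ X).2)
  have hdA : dg A = A := dg_lieAlg_F hF hA.1.1
  refine ⟨?_, a, ⟨W, hW⟩, ?_⟩
  · rw [hX, ← hφX, ← hdA, ← map_smul]
    exact ((blockTriangular_dg _).add (mem_nil_iff.1 hW).1).add (blockTriangular_dg _)
  · have h1 : X = a • (⟨A, Submodule.mem_sup_left hA.1⟩ : sR F) +
        Submodule.inclusion (show nil n ≤ sR F from le_sup_right) ⟨W, hW⟩ := Subtype.ext hX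
    rw [map_add, hφX, hX, map_add, map_smul, hdA, dg_nil hW, add_zero, smul_add, add_assoc]
    congr 1
    rw [h1, map_add, map_smul]
    rfl

/-- The condition on `g = ν f`, `f` the block-diagonal part, that is carried along horizontal
curves. The matrix `V` plays the part of a logarithm of `f` (it is the integral of the logarithmic
derivative of the block-diagonal part), seen by the determinants on the eigenspaces of `Z`. -/
def LogCondition (P : ℝ → Mat n) (Z : Mat n) (c : ℝ) (g : SLn n) : Prop :=
  Commute (dg (mat g)) Z ∧ ∃ V : Mat n,
    mat g (Sum.inr 0) (Sum.inr 0) = Complex.exp (V (Sum.inr 0) (Sum.inr 0)) ∧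
    (∀ l, detOn (P l) (dg (mat g)) = Complex.exp (P l * V).trace) ∧
    (Z * V).trace.re = c * (V (Sum.inr 0) (Sum.inr 0)).re

lemma LogCondition.horizontalArc {P : ℝ → Mat n} {Z : Mat n} (hZ : Z ∈ lieAlg (H F))
    (horth : ∀ W : nil n, kForm Z (nilMap φ W) = 0) (hP : ∀ l, P l * P l = P l)
    (hPc : ∀ M, Commute M Z → ∀ l, Commute M (P l)) {a b : SLn n}
    (ha : LogCondition P Z (Z * φ ⟨A, Submodule.mem_sup_left hA.1⟩).trace.re a)
    (hab : HorizontalArc F m a b) :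
    LogCondition P Z (Z * φ ⟨A, Submodule.mem_sup_left hA.1⟩).trace.re b := by
  obtain ⟨γ, u, rfl, rfl, hu, hγ⟩ := hab
  obtain ⟨hcomm, V₀, hV1, hV2, hV3⟩ := ha
  set U : Mat n := ((φ ⟨A, Submodule.mem_sup_left hA.1⟩ : lieAlg (H F)) : Mat n) with hU
  set c : ℝ := (Z * U).trace.re
  have hZs := lieAlg_H_le_suu hF hZ
  set κ : ℝ → Mat n := fun t => dg (mat (γ t))
  -- The logarithmic derivative of the block-diagonal part, extended to a continuous function.
  set v : ℝ → Mat n := fun t => dg (u (Set.projIcc (0 : ℝ) 1 zero_le_one t)) with hv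
  have hvI : ∀ t ∈ Set.Icc (0 : ℝ) 1, v t = dg (u t) := fun t ht => by
    rw [hv]; simp only [Set.projIcc_of_mem _ ht]
  have hum : ∀ t, u (Set.projIcc (0 : ℝ) 1 zero_le_one t) ∈ m := fun t =>
    (hγ _ (Set.projIcc (0 : ℝ) 1 zero_le_one t).2).2.1
  have hvc : Continuous v := by
    refine continuous_matrix fun i j => ?_
    simp only [hv, dg_apply]
    split_ifs
    · exact (continuousOn_iff_continuous_domRestrict.1 (hu i j)).comp continuous_projIcc
    · exact continuous_const
  have hvZ : ∀ t, Commute (v t) Z := fun t => by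
    obtain ⟨-, x, W, h⟩ := exists_dg_eq_of_mem hF hφ hA (hum t)
    rw [hv]
    simp only
    rw [h]
    exact ((commute_generator_add hF hφ hA hZ).smul_left x).add_left
      (commute_nilMap_of_orthogonal hF hφ hZ horth W)
  have hvtr : ∀ t, (Z * v t).trace.re = c * (v t (Sum.inr 0) (Sum.inr 0)).re := fun t => by
    obtain ⟨-, x, W, h⟩ := exists_dg_eq_of_mem hF hφ hA (hum t)
    have h1 : (v t (Sum.inr 0) (Sum.inr 0)).re = x := by
      change aCoord n (v t) = x
      rw [hv]
      simp only
      rw [h, map_add, map_smul, map_add, aCoord_generator hA,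
        ((mem_lieAlg_H_iff hF).1 (nilMap φ W).2).2, ((mem_lieAlg_H_iff hF).1 (φ _).2).2]
      simp
    have h2 : (Z * v t).trace.re = -kForm Z (v t) := by rw [kForm_suu_left hZs, neg_neg]
    have h3 : kForm Z A = 0 := by rw [kForm_comm]; exact hA.1.2 Z hZ
    rw [h1, h2, hv]
    simp only
    rw [h, kForm_add_right, horth, kForm_smul_right, kForm_add_right, h3, kForm_suu_left hZs]
    ring
  have hκ : ∀ t ∈ Set.Icc (0 : ℝ) 1, HasDerivWithinAt κ (κ t * v t) (Set.Icc 0 1) t := by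
    intro t ht
    obtain ⟨hG, hm, hd⟩ := hγ t ht
    rw [hvI t ht, ← dg_mul (G_le_parabolic hF hG).1 (exists_dg_eq_of_mem hF hφ hA hm).1,
      hasDerivWithinAt_matrix]
    intro i j
    simp only [κ, dg_apply]
    split_ifs
    · exact hd i j
    · exact hasDerivWithinAt_const _ _ _
  -- The block-diagonal part commutes with `Z`, by the uniqueness of solutions of `E' = E v`.
  have hκZ : ∀ t ∈ Set.Icc (0 : ℝ) 1, Commute (κ t) Z := by
    obtain ⟨K, hK⟩ := isCompact_Icc.exists_bound_of_continuousOn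
      (hvc.continuousOn (s := Set.Icc (0 : ℝ) 1))
    have hE : ∀ t ∈ Set.Icc (0 : ℝ) 1, HasDerivWithinAt (fun t => κ t * Z - Z * κ t)
        ((κ t * Z - Z * κ t) * v t) (Set.Icc 0 1) t := by
      intro t ht
      have h1 := ((hκ t ht).mul_const Z).sub ((hκ t ht).const_mul Z)
      have h2 : (κ t * Z - Z * κ t) * v t = κ t * v t * Z - Z * (κ t * v t) := by
        rw [Matrix.mul_assoc (κ t), (hvZ t).eq]
        noncomm_ring
      rw [h2]
      exact h1
    have h0 := eq_zero_of_abs_deriv_le_mul_abs_self_of_eq_zero_right (K := K)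
      (fun t ht => (hE t ht).continuousWithinAt)
      (fun t ht => (hE t (Set.Ico_subset_Icc_self ht)).mono_of_mem_nhdsWithin
        (Icc_mem_nhdsGE_of_mem ht)) (sub_eq_zero.2 hcomm.eq) (fun t ht => by
          rw [mul_comm K]
          exact (norm_mul_le _ _).trans (mul_le_mul_of_nonneg_left
            (hK t (Set.Ico_subset_Icc_self ht)) (norm_nonneg _)))
    exact fun t ht => sub_eq_zero.1 (h0 t ht)
  set V : ℝ → Mat n := fun t => ∫ s in (0 : ℝ)..t, v s with hV
  have hVd : ∀ t, HasDerivAt V (v t) t := fun t =>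
    (hvc.integral_hasStrictDerivAt 0 t).hasDerivAt
  have hV0 : V 0 = 0 := by simp [hV]
  have h01 : (0 : ℝ) ≤ 1 := zero_le_one
  refine ⟨hκZ 1 ⟨h01, le_rfl⟩, V₀ + V 1, ?_, fun l => ?_, ?_⟩
  · have h1 := eq_mul_exp_of_hasDerivWithinAt
      (y := fun t => κ t (Sum.inr 0) (Sum.inr 0)) (w := fun t => V t (Sum.inr 0) (Sum.inr 0))
      (c := fun t => v t (Sum.inr 0) (Sum.inr 0)) h01
      (fun t ht => by
        have h2 := hasDerivWithinAt_matrix.1 (hκ t ht) (Sum.inr 0) (Sum.inr 0)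
        have h3 : (κ t * v t) (Sum.inr 0) (Sum.inr 0) =
            κ t (Sum.inr 0) (Sum.inr 0) * v t (Sum.inr 0) (Sum.inr 0) := by
          rw [Matrix.mul_apply, Fintype.sum_sum_type, Fin.sum_univ_two]
          simp [κ, dg_apply]
        rwa [h3] at h2)
      (fun t _ => (hasDerivAt_matrix.1 (hVd t) _ _).hasDerivWithinAt)
    simp only [κ, dg_apply, if_true, hV0, Matrix.zero_apply, sub_zero] at h1
    rw [h1, hV1, Matrix.add_apply, Complex.exp_add]
  · have h1 := eq_mul_exp_of_hasDerivWithinAt (y := fun t => detOn (P l) (κ t))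
      (w := fun t => traceMul (P l) (V t)) (c := fun t => traceMul (P l) (v t)) h01
      (fun t ht => hasDerivWithinAt_detOn (hP l) (hPc _ (hκZ t ht) l) (hκ t ht))
      (fun t _ => (hasDerivAt_linearMap _ (hVd t)).hasDerivWithinAt)
    simp only [hV0, map_zero, sub_zero] at h1
    change detOn (P l) (κ 1) = _
    rw [h1, hV2, ← Complex.exp_add, Matrix.mul_add, trace_add]
    rfl
  · let L : Mat n →ₗ[ℝ] ℝ := Complex.reLm ∘ₗ traceMul Z - c • aCoord n
    have hL : ∀ M, L M = (Z * M).trace.re - c * (M (Sum.inr 0) (Sum.inr 0)).re := fun M => rfl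
    have h1 : ∀ t, HasDerivAt (fun t => L (V t)) 0 t := fun t => by
      have := hasDerivAt_linearMap L (hVd t)
      rwa [hL, hvtr, sub_self] at this
    have h2 := is_const_of_deriv_eq_zero (fun t => (h1 t).differentiableAt)
      (fun t => (h1 t).deriv) 1 0
    rw [hV0, map_zero, hL] at h2
    rw [Matrix.mul_add, trace_add, Complex.add_re, hV3, Matrix.add_apply, Complex.add_re]
    linarith

lemma logCondition_of_horizontallyJoined {P : ℝ → Mat n} {Z : Mat n} (hZ : Z ∈ lieAlg (H F))
    (horth : ∀ W : nil n, kForm Z (nilMap φ W) = 0) (hP : ∀ l, P l * P l = P l)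
    (hPc : ∀ M, Commute M Z → ∀ l, Commute M (P l)) {g : SLn n}
    (hg : HorizontallyJoined F m 1 g) :
    LogCondition P Z (Z * φ ⟨A, Submodule.mem_sup_left hA.1⟩).trace.re g := by
  induction hg with
  | refl => exact ⟨by simp, 0, by simp, by simp, by simp⟩
  | tail _ hbc ih => exact ih.horizontalArc hF hφ hA hZ horth hP hPc hbc

/-- A `C¹` curve in the holonomy group is orthogonal to the complement of the image of `𝔫`: the
integral of `tr (Z γ⁻¹ γ')` is continuous, and by the determinant characters it takes its values in
the countable group generated by the numbers `2 π l`, `l` an eigenvalue of `-i Z`. -/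
lemma kForm_eq_zero_of_mem_holonomyAlgebra {Z : Mat n} (hZ : Z ∈ lieAlg (H F))
    (horth : ∀ W : nil n, kForm Z (nilMap φ W) = 0) {Y : Mat n} (hY : Y ∈ holonomyAlgebra F m) :
    kForm Z Y = 0 := by
  have hZs := lieAlg_H_le_suu hF hZ
  obtain ⟨s, P, hP, hPc, hZP⟩ := exists_spectral_projections (conjTranspose_suu hZs)
  obtain ⟨γ, hγK, hγ⟩ := mem_lieAlg_iff.1 hY
  have hlog : ∀ t, LogCondition P Z _ (γ t) := fun t =>
    logCondition_of_horizontallyJoined hF hφ hA hZ horth hP hPc (hγK t).2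
  have hdgγ : ∀ t, dg (mat (γ t)) = mat (γ t) := fun t => dg_SUU (hγK t).1.2
  set γ' : ℝ → Mat n := fun t => of fun i j => deriv (fun t => mat (γ t) i j) t
  have hγd : ∀ t, HasDerivAt (fun t => mat (γ t)) (γ' t) t := fun t =>
    hasDerivAt_matrix.2 fun i j =>
      ((hγ.contDiff i j).differentiable one_ne_zero t).hasDerivAt
  have hγ'c : Continuous γ' := continuous_matrix fun i j =>
    (contDiff_one_iff_deriv.1 (hγ.contDiff i j)).2
  have hγc : Continuous fun t => mat (γ t) := continuous_matrix fun i j => (hγ.contDiff i j).continuous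
  set u : ℝ → Mat n := fun t => (mat (γ t)).adjugate * γ' t with hu
  have huc : Continuous u := hγc.matrix_adjugate.matrix_mul hγ'c
  have hγu : ∀ t, HasDerivAt (fun t => mat (γ t)) (mat (γ t) * u t) t := fun t => by
    have h1 : mat (γ t) * u t = γ' t := by
      rw [hu, ← Matrix.mul_assoc, mul_adjugate, det_mat, one_smul, Matrix.one_mul]
    rw [h1]
    exact hγd t
  have hu0 : u 0 = Y := by
    have h1 := (hγu 0).unique (hasDerivAt_matrix.2 hγ.hasDerivAt)
    rwa [hγ.zero, map_one, Matrix.one_mul] at h1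
  set V : ℝ → Mat n := fun t => ∫ s in (0 : ℝ)..t, u s with hV
  have hVd : ∀ t, HasDerivAt V (u t) t := fun t =>
    (huc.integral_hasStrictDerivAt 0 t).hasDerivAt
  have hV0 : V 0 = 0 := by simp [hV]
  have htrZ : ∀ M : Mat n, (Z * M).trace = ∑ l ∈ s, ((l : ℂ) * Complex.I) * (P l * M).trace := by
    intro M
    conv_lhs => rw [hZP]
    rw [Finset.sum_mul, trace_sum]
    refine Finset.sum_congr rfl fun l _ => ?_
    rw [smul_mul_assoc, trace_smul, smul_eq_mul]
  let L : Mat n →ₗ[ℝ] ℝ := Complex.reLm ∘ₗ traceMul Z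
  have hL : ∀ M, L M = (Z * M).trace.re := fun M => rfl
  have hcount : ∀ t, 0 ≤ t → L (V t) ∈ Set.range fun k : s → ℤ =>
      ∑ l : s, (l : ℝ) * (-(2 * Real.pi * k l)) := by
    intro t ht
    obtain ⟨-, V', hV1, hV2, hV3⟩ := hlog t
    have hre : (V' (Sum.inr 0) (Sum.inr 0)).re = 0 := by
      have h1 := norm_apply_SUU (hγK t).1.2
      rwa [hV1, Complex.norm_exp, Real.exp_eq_one_iff] at h1
    rw [hre, mul_zero] at hV3
    have hdet : ∀ l, Complex.exp (P l * V t).trace = Complex.exp (P l * V').trace := by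
      intro l
      have h1 := eq_mul_exp_of_hasDerivWithinAt (y := fun t => detOn (P l) (mat (γ t)))
        (w := fun t => traceMul (P l) (V t)) (c := fun t => traceMul (P l) (u t)) ht
        (fun r _ => hasDerivWithinAt_detOn (hP l)
          (hPc _ (by rw [← hdgγ]; exact (hlog r).1) l) (hγu r).hasDerivWithinAt)
        (fun r _ => (hasDerivAt_linearMap _ (hVd r)).hasDerivWithinAt)
      simp only [hV0, map_zero, sub_zero, hγ.zero, map_one, detOn_one, one_mul] at h1
      rw [← hV2 l, hdgγ, h1]
      rfl
    choose k hk using fun l => Complex.exp_eq_exp_iff_exists_int.1 (hdet l)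
    refine ⟨fun l => k l, ?_⟩
    simp only
    rw [Finset.sum_coe_sort s fun l : ℝ => l * (-(2 * Real.pi * k l)), ← add_zero (∑ l ∈ s, _),
      ← hV3, hL, htrZ, htrZ, Complex.re_sum, Complex.re_sum, ← Finset.sum_add_distrib]
    refine Finset.sum_congr rfl fun l _ => ?_
    rw [hk l]
    simp
    ring
  have hconst : ∀ t, 0 ≤ t → L (V t) = 0 := by
    intro t ht
    have hc : ContinuousOn (fun t => L (V t)) (Set.Ici 0) := fun t _ =>
      (hasDerivAt_linearMap L (hVd t)).continuousAt.continuousWithinAt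
    have h1 := (Set.countable_range _).isTotallyDisconnected _
      (Set.image_subset_iff.2 fun t ht => hcount t ht) (isPreconnected_Ici.image _ hc)
    have h2 := h1 ⟨t, ht, rfl⟩ ⟨0, Set.self_mem_Ici, rfl⟩
    simpa [hV0] using h2
  have h1 := (hasDerivAt_linearMap L (hVd 0)).hasDerivWithinAt (s := Set.Ici 0)
  have h2 : HasDerivWithinAt (fun t => L (V t)) 0 (Set.Ici 0) 0 :=
    (hasDerivWithinAt_const (0 : ℝ) (Set.Ici 0) (0 : ℝ)).congr (fun t ht => hconst t ht)
      (hconst 0 le_rfl)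
  have h3 := (uniqueDiffWithinAt_Ici (0 : ℝ)).eq_deriv _ h1 h2
  rw [hu0, hL] at h3
  rw [kForm_suu_left hZs, h3, neg_zero]

lemma exists_nilMap_eq_of_mem_holonomyAlgebra {Y : Mat n} (hY : Y ∈ holonomyAlgebra F m) :
    ∃ X : nil n, (nilMap φ X : Mat n) = Y := by
  obtain ⟨Y₀, ⟨X, rfl⟩, hortho⟩ := exists_orthogonal_projection
    (LinearMap.range ((lieAlg (H F)).subtype ∘ₗ nilMap φ)) Y
  refine ⟨X, ?_⟩
  have hYH : Y ∈ lieAlg (H F) := lieAlg_mono (fun g hg => (mem_holonomyGroup_iff.1 hg).1) hY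
  set Z : Mat n := Y - ((lieAlg (H F)).subtype ∘ₗ nilMap φ) X with hZ
  have hZH : Z ∈ lieAlg (H F) := sub_mem hYH (nilMap φ X).2
  have h1 := kForm_eq_zero_of_mem_holonomyAlgebra hF hφ hA hZH
    (fun W => hortho _ ⟨W, rfl⟩) hY
  have h2 : kForm Z Z = 0 := by
    conv_lhs => rw [hZ]
    rw [← hZ, kForm_sub_right, h1, hortho _ ⟨X, rfl⟩, sub_zero]
  exact (sub_eq_zero.1 (kForm_self_eq_zero h2)).symm

end F

end CHn

end

theorem mainTheorem4 (n : ℕ) (hn : 1 ≤ n)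
    (F : Subgroup (CHn.SLn n)) (hF : CHn.IsAdmissible F)
    (m : Submodule ℝ (CHn.Mat n)) (hm : CHn.IsReductive F m) :
    (∃! A : CHn.Mat n, CHn.IsGenerator F A) ∧
    (∃! φr : CHn.sR F →ₗ[ℝ] CHn.lieAlg (CHn.H F), CHn.IsGraphMap F m φr) ∧
    ∀ (A : CHn.Mat n) (hA : CHn.IsGenerator F A)
      (φr : CHn.sR F →ₗ[ℝ] CHn.lieAlg (CHn.H F)), CHn.IsGraphMap F m φr →
      (CHn.holonomyAlgebra F m : Set (CHn.Mat n)) =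
        {Y | ∃ X : CHn.sR F, (X : CHn.Mat n) ∈ CHn.nil n ∧ (φr X : CHn.Mat n) = Y} ∧
      (CHn.holonomyAlgebra F m : Set (CHn.Mat n)) =
        {Y | ∃ X : CHn.sLie n, (X : CHn.Mat n) ∈ CHn.nil n ∧
          ((φr ∘ₗ CHn.chi F hA) X : CHn.Mat n) = Y} := by
  obtain ⟨A₀, hA₀, -⟩ := CHn.existsUnique_generator hF
  refine ⟨CHn.existsUnique_generator hF, CHn.existsUnique_graphMap hF hA₀ hm,
    fun A hA φr hφ => ?_⟩
  have h1 : (CHn.holonomyAlgebra F m : Set (CHn.Mat n)) =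
      {Y | ∃ X : CHn.sR F, (X : CHn.Mat n) ∈ CHn.nil n ∧ (φr X : CHn.Mat n) = Y} := by
    ext Y
    constructor
    · intro hY
      obtain ⟨X, hX⟩ := CHn.exists_nilMap_eq_of_mem_holonomyAlgebra hF hφ hA hY
      exact ⟨_, X.2, hX⟩
    · rintro ⟨X, hX, rfl⟩
      exact CHn.nilMap_mem_holonomyAlgebra hF hm hφ hA ⟨X, hX⟩
  -- On `𝔫` the map `χ_r` is the identity.
  have hchi : ∀ X : CHn.sLie n, (X : CHn.Mat n) ∈ CHn.nil n →
      (CHn.chi F hA X : CHn.Mat n) = X := by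
    intro X hX
    simp [CHn.chi, CHn.aCoord_nil hX]
  refine ⟨h1, h1.trans (Set.ext fun Y => ⟨?_, ?_⟩)⟩
  · rintro ⟨X, hX, rfl⟩
    refine ⟨⟨X, Submodule.mem_sup_right hX⟩, hX, ?_⟩
    rw [LinearMap.comp_apply]
    congr 2
    exact Subtype.ext (hchi ⟨X, Submodule.mem_sup_right hX⟩ hX)
  · rintro ⟨X, hX, rfl⟩
    exact ⟨CHn.chi F hA X, by rwa [hchi X hX], rfl⟩
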